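/- Let $k\ge 2$ and $d\ge 0$ be fixed integers and let $\mathbf T^d=\mathbb R^d/\mathbb Z^d$ be the flat unit torus with its uniform (Lebesgue) probability measure. Let $F_{in},F_{out}:\mathbf T^d\to[0,1]$ be measurable even functions (for instance, functions of $\|x\|_\infty$ only), put $\mu_{in}=\int_{\mathbf T^d}F_{in}(x)\,dx$, $\mu_{out}=\int_{\mathbf T^d}F_{out}(x)\,dx$, and for $z\in\mathbb Z^d$ let $\hat F(z)=\int_{\mathbf T^d}F(x)e^{-2\pi \mathrm i\langle z,x\rangle}\,dx$. For $n$ divisible by $k$ and an assignment $\sigma:[n]\to[k]$ of $n$ vertices to $k$ communities, each of size $n/k$, the soft geometric block model is the following random graph on $[n]$. Choose $X_1,\dots,X_n$ independently and uniformly in $\mathbf T^d$; given $X$, the graph with adjacency matrix $A=(a_{ij})$ is chosen with probability $$\prod_{1\le i<j\le n}F(X_i-X_j,\sigma_i,\sigma_j)^{a_{ij}}\bigl(1-F(X_i-X_j,\sigma_i,\sigma_j)\bigr)^{1-a_{ij}},$$ where $F(x,a,b)=F_{in}(x)$ if $a=b$ and $F(x,a,b)=F_{out}(x)$ if $a\ne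 b$. Assume that - $F_{in}(0)=\lim_{N\to\infty}\sum_{\|z\|_\infty\le N}\hat F_{in}(z)$ and $F_{out}(0)=\lim_{N\to\infty}\sum_{\|z\|_\infty\le N}\hat F_{out}(z)$ (each function equals its Fourier series at $0$); - $\mu_{in}>\mu_{out}>0$; - $\hat F_{in}(z)+(k-1)\hat F_{out}(z)\ne\mu_{in}-\mu_{out}$ for all $z\in\mathbb Z^d$; - $\hat F_{in}(z)-\hat F_{out}(z)\ne\mu_{in}-\mu_{out}$ for all $z\in\mathbb Z^d\setminus\{0\}$. Then there is $\varepsilon>0$ such that for every $\tau$ with $0<\tau<\varepsilon$ and every choice, for each multiple $n$ of $k$, of an assignment $\sigma^{(n)}$ of $[n]$ into $k$ communities of size $n/k$, the following holds with probability tending to $1$ as $n\to\infty$ through the multiples of $k$. Put $\lambda_*=n(\mu_{in}-\mu_{out})/k$. Counted with multiplicity, exactly $k-1$ eigenvalues of $A$ lie in the open interval $(\lambda_*-\tau n,\lambda_*+\tau n)$, and every other eigenvalue $\lambda$ of $A$ satisfies $|\lambda-\lambda_*|\ge\varepsilon n$. -/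

import Mathlib

open MeasureTheory Filter Topology

noncomputable section

namespace SGBM

/-- The uniform (normalised Haar, i.e. Lebesgue) probability measure on the flat unit torus
`𝐓^d = ℝ^d / ℤ^d`. It is the measure with respect to which `UnitAddTorus.mFourierCoeff` integrates. -/
def torusMeasure (d : ℕ) : Measure (UnitAddTorus (Fin d)) :=
  Measure.pi fun _ => AddCircle.haarAddCircle

instance (d : ℕ) : IsProbabilityMeasure (torusMeasure d) := by
  unfold torusMeasure; infer_instance

/-- `f̂(z) = ∫_{𝐓^d} f(x) e^{-2πi⟨z,x⟩} dx` for a real-valued function `f` on the torus. -/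
def fourierCoef {d : ℕ} (f : UnitAddTorus (Fin d) → ℝ) (z : Fin d → ℤ) : ℂ :=
  UnitAddTorus.mFourierCoeff (fun x => (f x : ℂ)) z

/-- The mean `∫_{𝐓^d} f(x) dx` (the expected edge density of a connectivity function). -/
def density {d : ℕ} (f : UnitAddTorus (Fin d) → ℝ) : ℝ :=
  ∫ x, f x ∂(torusMeasure d)

/-- The Fourier series of `f` evaluated at `0`, i.e. the limit of the partial sums of `f̂(z)` over
the cubes `‖z‖_∞ ≤ N`, converges to `f(0)`. -/
def FourierSeriesAtZero {d : ℕ} (f : UnitAddTorus (Fin d) → ℝ) : Prop :=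
  Tendsto
    (fun N : ℕ => ∑ z ∈ Fintype.piFinset fun _ : Fin d => Finset.Icc (-(N : ℤ)) (N : ℤ),
      fourierCoef f z)
    atTop (𝓝 (f 0 : ℂ))

/-- A measurable, even connectivity probability function `𝐓^d → [0,1]`. Evenness holds for every
function of the distance `‖x‖`; it makes the probability of the undirected edge `{i,j}`
independent of the order of `i` and `j`. -/
structure IsConnectivity {d : ℕ} (f : UnitAddTorus (Fin d) → ℝ) : Prop where
  measurable : Measurable f
  mem_Icc : ∀ x, f x ∈ Set.Icc (0 : ℝ) 1
  even : ∀ x, f (-x) = f x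

/-- The function `F(x, a, b)`: it is `F_in(x)` if the communities `a`, `b` agree and `F_out(x)`
otherwise. -/
def connect {d k : ℕ} (Fi Fo : UnitAddTorus (Fin d) → ℝ)
    (x : UnitAddTorus (Fin d)) (a b : Fin k) : ℝ :=
  if a = b then Fi x else Fo x

open Classical in
/-- The conditional probability of the graph `G`, given the communities `σ` and the positions `X`:
`∏_{i<j} F(X_i - X_j, σ_i, σ_j)^{a_ij} (1 - F(X_i - X_j, σ_i, σ_j))^{1 - a_ij}`. -/
def condProb {d k n : ℕ} (Fi Fo : UnitAddTorus (Fin d) → ℝ) (σ : Fin n → Fin k)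
    (X : Fin n → UnitAddTorus (Fin d)) (G : SimpleGraph (Fin n)) : ℝ :=
  ∏ p ∈ Finset.univ.filter fun p : Fin n × Fin n => p.1 < p.2,
    if G.Adj p.1 p.2 then connect Fi Fo (X p.1 - X p.2) (σ p.1) (σ p.2)
    else 1 - connect Fi Fo (X p.1 - X p.2) (σ p.1) (σ p.2)

/-- The law of the random graph of the soft geometric block model on `n` vertices with communities
`σ`: the positions are independent and uniform in the torus and, given the positions, the graph is
drawn with probabilities `condProb`. -/
def law {d k n : ℕ} (Fi Fo : UnitAddTorus (Fin d) → ℝ) (σ : Fin n → Fin k) :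
    Measure (SimpleGraph (Fin n)) :=
  Measure.sum fun G : SimpleGraph (Fin n) =>
    (∫⁻ X, ENNReal.ofReal (condProb Fi Fo σ X G) ∂(Measure.pi fun _ : Fin n => torusMeasure d)) •
      Measure.dirac G

/-- All `k` communities have the same size `n / k` (in particular `k` divides `n`). -/
def IsBalanced {k n : ℕ} (σ : Fin n → Fin k) : Prop :=
  ∀ q : Fin k, k * (Finset.univ.filter fun i => σ i = q).card = n

open Classical in
theorem adjMatrix_isHermitian {n : ℕ} (G : SimpleGraph (Fin n)) :
    (G.adjMatrix ℝ).IsHermitian := by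
  ext i j
  simp [SimpleGraph.adjMatrix_apply, SimpleGraph.adj_comm]

open Classical in
/-- The `n` eigenvalues, listed with multiplicity, of the adjacency matrix of `G`. -/
def eigenvalue {n : ℕ} (G : SimpleGraph (Fin n)) : Fin n → ℝ :=
  (adjMatrix_isHermitian G).eigenvalues

/-- Exactly `r` eigenvalues of the adjacency matrix of `G` (with multiplicity) lie in the open
interval `(c - τ n, c + τ n)`, and all the others are at distance at least `ε n` from `c`. -/
def IsolatedCluster {n : ℕ} (G : SimpleGraph (Fin n)) (c τ ε : ℝ) (r : ℕ) : Prop :=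
  {i | eigenvalue G i ∈ Set.Ioo (c - τ * n) (c + τ * n)}.ncard = r ∧
  ∀ i, eigenvalue G i ∉ Set.Ioo (c - τ * n) (c + τ * n) → ε * n ≤ |eigenvalue G i - c|

end SGBM

end

/-! Divide the adjacency matrix by `n` and split it into its conditional mean given the positions
plus noise. Since `e_z(x - y) = e_z(x) * conj (e_z(y))`, truncating the Fourier series to a finite
set `Z` of modes replaces the mean by `U D U*`. The columns of `U` are the characters sampled at the
positions, restricted to one community and normalised. `D` is block diagonal: the block of mode `z`
is `α + β J`, with `J` the all-ones matrix, `α = (F̂in(z) - F̂out(z)) / k` and `β = F̂out(z) / k`.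
It acts as `α` on zero-sum vectors and as `α + kβ` on constants. At `z = 0` the first eigenvalue is
`c = (μin - μout) / k`, with multiplicity `k - 1`. By hypothesis no other block eigenvalue equals
`c`, and since the coefficients tend to `0` while `c > 0`, all others stay at distance at least some
`g > 0` (`exists_spectral_gap`).

Three errors are small with high probability. `U*U - 1` has mean square `O(1/n)`, because distinct
characters are orthogonal (`integral_frobeniusSq_gram_le`). The truncation error in Frobenius norm
is governed by the `L²` tail of the Fourier series, since `X i - X j` is uniform for `i ≠ j`
(`integral_frobeniusSq_mean_sub_le`). The noise has operator norm `O(n^(3/4))` by a fourth moment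
bound (`sum_graphWeight_mul_frobenius_le`).

On the good event no eigenvectors need to be followed. The community vectors with zero-sum weights
form a `(k - 1)`-dimensional space of approximate eigenvectors (`norm_sub_smul_le_of_eigenvector`).
On their orthogonal complement the scaled matrix minus `c` is bounded below by `g / 4`
(`le_norm_sub_smul_of_gap`). Dimension counting turns these facts into a lower and an upper bound,
both `k - 1`, for the number of eigenvalues near `c` (`isolated_eigenvalues`). -/

namespace SGBM

/-! ### Perturbation of `U D U*` for an almost isometric `U`. -/

section Hilbert

open ContinuousLinearMap InnerProductSpace

variable {H E : Type*} [NormedAddCommGroup H] [InnerProductSpace ℂ H] [CompleteSpace H]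
  [NormedAddCommGroup E] [InnerProductSpace ℂ E] [CompleteSpace E]

/-- An approximate isometry almost preserves the square of the norm. -/
theorem abs_norm_sq_sub_le_of_approx_isometry (U : E →L[ℂ] H) {η : ℝ}
    (hU : ∀ y, ‖adjoint U (U y) - y‖ ≤ η * ‖y‖) (y : E) :
    |‖U y‖ ^ 2 - ‖y‖ ^ 2| ≤ η * ‖y‖ ^ 2 := by
  have h : ‖U y‖ ^ 2 - ‖y‖ ^ 2 = RCLike.re (inner ℂ (adjoint U (U y) - y) y) := by
    rw [inner_sub_left, adjoint_inner_left, map_sub, inner_self_eq_norm_sq, inner_self_eq_norm_sq]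
  rw [h]
  calc _ ≤ ‖inner ℂ (adjoint U (U y) - y) y‖ := RCLike.abs_re_le_norm _
    _ ≤ ‖adjoint U (U y) - y‖ * ‖y‖ := norm_inner_le_norm _ _
    _ ≤ η * ‖y‖ * ‖y‖ := by gcongr; exact hU y
    _ = _ := by ring

/-- If `T` is close to `U D U*` with `U` almost isometric, then `U` maps eigenvectors of `D` to
approximate eigenvectors of `T`. -/
theorem norm_sub_smul_le_of_eigenvector (U : E →L[ℂ] H) (D : E →L[ℂ] E) (T : H →L[ℂ] H) {η : ℝ}
    (hη : η ≤ 3 / 4) (hη0 : 0 ≤ η)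
    (hU : ∀ y, ‖adjoint U (U y) - y‖ ≤ η * ‖y‖)
    (hT : ∀ w, ‖T w - U (D (adjoint U w))‖ ≤ η * ‖w‖)
    (hD : ∀ y, ‖D y‖ ≤ ‖y‖) {c : ℂ} {b : E} (hb : D b = c • b) :
    ‖T (U b) - c • U b‖ ≤ 5 * η * ‖U b‖ ∧ ‖b‖ ≤ 2 * ‖U b‖ := by
  have hle : ‖b‖ ≤ 2 * ‖U b‖ := by
    have := abs_le.1 (abs_norm_sq_sub_le_of_approx_isometry U hU b)
    refine le_of_sq_le_sq ?_ (by positivity)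
    nlinarith [sq_nonneg ‖b‖]
  refine ⟨?_, hle⟩
  -- As `c • U b = U (D b)`, the defect is the error of `T` at `U b` plus `U (D e)`. The constant `5
  -- = 1 + 2 * 2` combines `‖U (D e)‖ ≤ 2 ‖D e‖` with `‖b‖ ≤ 2 ‖U b‖`.
  set e := adjoint U (U b) - b with he
  have hUe : ‖U (D e)‖ ≤ 2 * ‖D e‖ := by
    have := abs_le.1 (abs_norm_sq_sub_le_of_approx_isometry U hU (D e))
    refine le_of_sq_le_sq ?_ (by positivity)
    nlinarith [sq_nonneg ‖D e‖]
  have heq : T (U b) - c • U b = (T (U b) - U (D (adjoint U (U b)))) + U (D e) := by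
    rw [he, map_sub, map_sub, hb, map_smul]; abel
  rw [heq]
  calc _ ≤ η * ‖U b‖ + 2 * (η * ‖b‖) :=
        (norm_add_le _ _).trans (add_le_add (hT _) (hUe.trans (by grw [hD e, hU b])))
    _ ≤ η * ‖U b‖ + 2 * (η * (2 * ‖U b‖)) := by gcongr
    _ = _ := by ring

/-- If `T` is close to `U D U*` with `U` almost isometric, then `T - c` is bounded below at all `w`
for which `D - c` is bounded below at `U* w`. -/
theorem le_norm_sub_smul_of_gap (U : E →L[ℂ] H) (D : E →L[ℂ] E) (T : H →L[ℂ] H) {η g c : ℝ}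
    (hg : 0 < g) (hgc : g ≤ c) (hc : c ≤ 1) (hη : η ≤ g ^ 2 / 16) (hη0 : 0 ≤ η)
    (hU : ∀ y, ‖adjoint U (U y) - y‖ ≤ η * ‖y‖)
    (hT : ∀ w, ‖T w - U (D (adjoint U w))‖ ≤ η * ‖w‖)
    (hD : ∀ y, ‖D y‖ ≤ ‖y‖) {w : H}
    (hw : g * ‖adjoint U w‖ ≤ ‖D (adjoint U w) - (c : ℂ) • adjoint U w‖) :
    g / 4 * ‖w‖ ≤ ‖T w - (c : ℂ) • w‖ := by
  set y := adjoint U w with hy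
  set u := D y - (c : ℂ) • y with hu
  -- Here `(U D U* - c) w = U u - c r`, and the two terms are almost orthogonal because `U* r = y -
  -- U* U y` is small. The gap of `D` controls the first term and `c ≥ g` the second.
  set r := w - U y with hr
  have hg1 : g ≤ 1 := hgc.trans hc
  have hη1 : η ≤ 1 / 16 := by nlinarith
  have hηg : η ≤ g / 16 := by nlinarith
  have hun : ‖u‖ ≤ 2 * ‖y‖ := by
    calc _ ≤ ‖D y‖ + ‖(c : ℂ) • y‖ := norm_sub_le _ _
      _ ≤ ‖y‖ + 1 * ‖y‖ := by
        gcongr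
        · exact hD y
        · rw [norm_smul, Complex.norm_real, Real.norm_eq_abs, abs_of_pos (by linarith)]
          gcongr
      _ = _ := by ring
  have hUr : ‖adjoint U r‖ ≤ η * ‖y‖ := by
    have : adjoint U r = -(adjoint U (U y) - y) := by rw [hr, map_sub]; abel
    rw [this, norm_neg]; exact hU y
  have hin : |RCLike.re (inner ℂ (U u) r)| ≤ 2 * ‖y‖ * (η * ‖y‖) := by
    rw [← adjoint_inner_right]
    calc _ ≤ ‖inner ℂ u (adjoint U r)‖ := RCLike.abs_re_le_norm _
      _ ≤ ‖u‖ * ‖adjoint U r‖ := norm_inner_le_norm _ _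
      _ ≤ _ := by gcongr
  have hsq : ‖U u - (c : ℂ) • r‖ ^ 2
      = ‖U u‖ ^ 2 - 2 * (c * RCLike.re (inner ℂ (U u) r)) + (c * ‖r‖) ^ 2 := by
    rw [@norm_sub_sq ℂ, inner_smul_right, norm_smul, Complex.norm_real, Real.norm_eq_abs,
      abs_of_pos (by linarith : 0 < c)]
    congr 3
    simp
  have hUu := abs_le.1 (abs_norm_sq_sub_le_of_approx_isometry U hU u)
  have hUy := abs_le.1 (abs_norm_sq_sub_le_of_approx_isometry U hU y)
  have hu2 : g ^ 2 * ‖y‖ ^ 2 ≤ ‖u‖ ^ 2 := by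
    rw [← mul_pow]; gcongr
  -- Approximate Pythagoras: the cross term is at most `4 η ‖y‖ ^ 2 ≤ g ^ 2 / 4 * ‖y‖ ^ 2`, which is
  -- what `η ≤ g ^ 2 / 16` is for.
  have hlow : g ^ 2 / 2 * ‖y‖ ^ 2 + g ^ 2 * ‖r‖ ^ 2 ≤ ‖U u - (c : ℂ) • r‖ ^ 2 := by
    rw [hsq]
    have h1 : c * RCLike.re (inner ℂ (U u) r) ≤ 2 * (η * ‖y‖ ^ 2) := by
      calc _ ≤ c * (2 * ‖y‖ * (η * ‖y‖)) := by
            gcongr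
            · linarith
            · exact (le_abs_self _).trans hin
        _ ≤ 1 * (2 * ‖y‖ * (η * ‖y‖)) := by gcongr
        _ = _ := by ring
    have h2 : g ^ 2 * ‖r‖ ^ 2 ≤ (c * ‖r‖) ^ 2 := by rw [mul_pow]; gcongr
    have h3 : η * ‖y‖ ^ 2 ≤ g ^ 2 / 16 * ‖y‖ ^ 2 := by gcongr
    have h4 : η * ‖u‖ ^ 2 ≤ 1 / 16 * ‖u‖ ^ 2 := by gcongr
    nlinarith [sq_nonneg (g * ‖y‖)]
  have hwn : ‖w‖ ^ 2 ≤ 4 * ‖y‖ ^ 2 + 2 * ‖r‖ ^ 2 := by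
    have h1 : ‖w‖ ≤ ‖U y‖ + ‖r‖ := by
      have : w = U y + r := by rw [hr]; abel
      calc ‖w‖ = ‖U y + r‖ := by rw [← this]
        _ ≤ _ := norm_add_le _ _
    have h2 : ‖w‖ ^ 2 ≤ (‖U y‖ + ‖r‖) ^ 2 := by gcongr
    have h4 : η * ‖y‖ ^ 2 ≤ 1 / 16 * ‖y‖ ^ 2 := by gcongr
    nlinarith [sq_nonneg (‖U y‖ - ‖r‖), sq_nonneg ‖y‖]
  have hmain : g / 3 * ‖w‖ ≤ ‖U u - (c : ℂ) • r‖ := by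
    refine le_of_sq_le_sq ?_ (norm_nonneg _)
    refine le_trans ?_ hlow
    rw [mul_pow]
    nlinarith [mul_le_mul_of_nonneg_left hwn (sq_nonneg g), mul_nonneg (sq_nonneg g) (sq_nonneg ‖y‖),
      mul_nonneg (sq_nonneg g) (sq_nonneg ‖r‖), sq_nonneg ‖w‖, sq_nonneg g]
  have heq : U u - (c : ℂ) • r = (T w - (c : ℂ) • w) - (T w - U (D y)) := by
    rw [hu, hr, map_sub, map_smul, smul_sub]; abel
  have := hT w
  have h5 : ‖U u - (c : ℂ) • r‖ ≤ ‖T w - (c : ℂ) • w‖ + η * ‖w‖ := by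
    rw [heq]; exact (norm_sub_le _ _).trans (by gcongr)
  have h6 : η * ‖w‖ ≤ g / 16 * ‖w‖ := by gcongr
  nlinarith [mul_nonneg hg.le (norm_nonneg w)]

end Hilbert

/-! ### Counting eigenvalues by dimension. -/

section Counting

variable {n : ℕ} {A : Matrix (Fin n) (Fin n) ℝ} (hA : A.IsHermitian)

/-- The square norm of `(A - c) v` in terms of the spectral decomposition of `A`. -/
theorem norm_sq_toEuclideanLin_sub_smul (c : ℝ) (v : EuclideanSpace ℝ (Fin n)) :
    ‖Matrix.toEuclideanLin A v - c • v‖ ^ 2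
      = ∑ i, (hA.eigenvalues i - c) ^ 2 * inner ℝ (hA.eigenvectorBasis i) v ^ 2 := by
  rw [← hA.eigenvectorBasis.sum_sq_norm_inner_right]
  refine Finset.sum_congr rfl fun i _ => ?_
  have hs : (Matrix.toEuclideanLin A).IsSymmetric := Matrix.isSymmetric_toEuclideanLin_iff.2 hA
  have he : Matrix.toEuclideanLin A (hA.eigenvectorBasis i)
      = hA.eigenvalues i • hA.eigenvectorBasis i := by
    ext j
    simpa using congrFun (hA.mulVec_eigenvectorBasis i) j
  rw [inner_sub_right, ← hs, he, inner_smul_left, inner_smul_right, ← mul_pow, Real.norm_eq_abs,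
    sq_abs, RCLike.conj_to_real, sub_mul]

/-- A subspace on which `A` is `τ`-close to `c` forces eigenvalues near `c`. -/
theorem finrank_le_ncard_eigenvalues {W : Type*} [AddCommGroup W] [Module ℝ W]
    [FiniteDimensional ℝ W] (f : W →ₗ[ℝ] EuclideanSpace ℝ (Fin n)) {c τ : ℝ}
    (hf : ∀ b, b ≠ 0 → ‖Matrix.toEuclideanLin A (f b) - c • f b‖ < τ * ‖f b‖) :
    Module.finrank ℝ W ≤ {i | hA.eigenvalues i ∈ Set.Ioo (c - τ) (c + τ)}.ncard := by
  classical
  set S : Set (Fin n) := {i | hA.eigenvalues i ∈ Set.Ioo (c - τ) (c + τ)} with hS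
  by_contra! hlt
  -- With fewer than `finrank W` eigenvalues near `c`, some nonzero `b` has an image with no
  -- component along their eigenvectors; all its components have `|λ - c| ≥ τ`.
  let q : W →ₗ[ℝ] (S → ℝ) := LinearMap.pi fun i => (innerₛₗ ℝ (hA.eigenvectorBasis i.1)).comp f
  have hker : LinearMap.ker q ≠ ⊥ := by
    apply LinearMap.ker_ne_bot_of_finrank_lt
    rwa [Module.finrank_fintype_fun_eq_card, ← Nat.card_eq_fintype_card, Nat.card_coe_set_eq]
  obtain ⟨b, hb, hb0⟩ := (Submodule.ne_bot_iff _).1 hker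
  have hz : ∀ i ∈ S, inner ℝ (hA.eigenvectorBasis i) (f b) = 0 := fun i hi =>
    congrFun (LinearMap.mem_ker.1 hb) ⟨i, hi⟩
  have hlt := hf b hb0
  have hτ : 0 < τ := by
    by_contra! h
    exact absurd (hlt.trans_le (mul_nonpos_of_nonpos_of_nonneg h (norm_nonneg _)))
      (not_lt.2 (norm_nonneg _))
  have hsq := pow_lt_pow_left₀ hlt (norm_nonneg _) two_ne_zero
  rw [norm_sq_toEuclideanLin_sub_smul hA, mul_pow, ← hA.eigenvectorBasis.sum_sq_norm_inner_right,
    Finset.mul_sum] at hsq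
  refine absurd hsq (not_lt.2 (Finset.sum_le_sum fun i _ => ?_))
  rw [Real.norm_eq_abs, sq_abs]
  by_cases hi : i ∈ S
  · simp [hz i hi]
  · refine mul_le_mul_of_nonneg_right ?_ (sq_nonneg _)
    rw [← sq_abs (hA.eigenvalues i - c)]
    gcongr
    by_contra! h
    rw [abs_lt] at h
    exact hi ⟨by linarith, by linarith⟩

/-- A subspace of small codimension on which `A - c` is bounded below by `ε` bounds the number of
eigenvalues near `c`. -/
theorem ncard_eigenvalues_le_finrank {W : Type*} [AddCommGroup W] [Module ℝ W]
    [FiniteDimensional ℝ W] (q : EuclideanSpace ℝ (Fin n) →ₗ[ℝ] W) {c ε : ℝ}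
    (hq : ∀ w, q w = 0 → ε * ‖w‖ ≤ ‖Matrix.toEuclideanLin A w - c • w‖) :
    {i | hA.eigenvalues i ∈ Set.Ioo (c - ε) (c + ε)}.ncard ≤ Module.finrank ℝ W := by
  classical
  set S : Set (Fin n) := {i | hA.eigenvalues i ∈ Set.Ioo (c - ε) (c + ε)} with hS
  by_contra! hlt
  -- Dually, too many eigenvalues near `c` give a nonzero combination of their eigenvectors killed
  -- by `q`.
  let f : (S → ℝ) →ₗ[ℝ] EuclideanSpace ℝ (Fin n) :=
    Fintype.linearCombination ℝ fun i : S => hA.eigenvectorBasis i.1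
  have hker : LinearMap.ker (q.comp f) ≠ ⊥ := by
    apply LinearMap.ker_ne_bot_of_finrank_lt
    rwa [Module.finrank_fintype_fun_eq_card, ← Nat.card_eq_fintype_card, Nat.card_coe_set_eq]
  obtain ⟨a, ha, ha0⟩ := (Submodule.ne_bot_iff _).1 hker
  have hfi : ∀ i, inner ℝ (hA.eigenvectorBasis i) (f a) = if h : i ∈ S then a ⟨i, h⟩ else 0 := by
    intro i
    simp only [f, Fintype.linearCombination_apply, inner_sum, inner_smul_right,
      orthonormal_iff_ite.1 hA.eigenvectorBasis.orthonormal]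
    split_ifs with h
    · rw [Finset.sum_eq_single ⟨i, h⟩] <;> simp +contextual [Subtype.ext_iff, eq_comm]
    · refine Finset.sum_eq_zero fun j _ => ?_
      rw [if_neg, mul_zero]
      rintro rfl
      exact h j.2
  obtain ⟨j, hj⟩ : ∃ j, a j ≠ 0 := Function.ne_iff.1 ha0
  have hε : 0 < ε := by
    have := j.2.1.trans j.2.2
    linarith
  have hsq := pow_le_pow_left₀ (by positivity) (hq (f a) (LinearMap.mem_ker.1 ha)) 2
  rw [norm_sq_toEuclideanLin_sub_smul hA, mul_pow, ← hA.eigenvectorBasis.sum_sq_norm_inner_right,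
    Finset.mul_sum] at hsq
  have hlt' : ∀ i ∈ S, (hA.eigenvalues i - c) ^ 2 < ε ^ 2 := fun i hi =>
    sq_lt_sq' (by linarith [hi.1]) (by linarith [hi.2])
  refine absurd hsq (not_le.2 (Finset.sum_lt_sum (fun i _ => ?_) ⟨j.1, Finset.mem_univ _, ?_⟩))
  · rw [Real.norm_eq_abs, sq_abs, hfi]
    split_ifs with h
    · have := (hlt' i h).le
      gcongr
    · simp
  · rw [Real.norm_eq_abs, sq_abs, hfi, dif_pos j.2]
    have := hlt' j j.2
    have h2 : 0 < a j ^ 2 := by positivity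
    exact mul_lt_mul_of_pos_right this h2

/-- Combination of the two counting bounds. -/
theorem isolated_eigenvalues {W W' : Type*} [AddCommGroup W] [Module ℝ W]
    [FiniteDimensional ℝ W] [AddCommGroup W'] [Module ℝ W'] [FiniteDimensional ℝ W'] {r : ℕ}
    (f : W →ₗ[ℝ] EuclideanSpace ℝ (Fin n)) (q : EuclideanSpace ℝ (Fin n) →ₗ[ℝ] W') {c τ ε : ℝ}
    (hW : Module.finrank ℝ W = r) (hW' : Module.finrank ℝ W' = r) (hτε : τ ≤ ε)
    (hf : ∀ b, b ≠ 0 → ‖Matrix.toEuclideanLin A (f b) - c • f b‖ < τ * ‖f b‖)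
    (hq : ∀ w, q w = 0 → ε * ‖w‖ ≤ ‖Matrix.toEuclideanLin A w - c • w‖) :
    {i | hA.eigenvalues i ∈ Set.Ioo (c - τ) (c + τ)}.ncard = r ∧
    ∀ i, hA.eigenvalues i ∉ Set.Ioo (c - τ) (c + τ) → ε ≤ |hA.eigenvalues i - c| := by
  have h1 := finrank_le_ncard_eigenvalues hA f hf
  have h2 := ncard_eigenvalues_le_finrank hA q hq
  have hsub : {i | hA.eigenvalues i ∈ Set.Ioo (c - τ) (c + τ)}
      ⊆ {i | hA.eigenvalues i ∈ Set.Ioo (c - ε) (c + ε)} := fun i hi =>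
    ⟨by linarith [hi.1], by linarith [hi.2]⟩
  rw [hW] at h1
  rw [hW'] at h2
  -- The narrow window holds at least `r` eigenvalues and the wide one at most `r`, so they hold the
  -- same ones and nothing lies between.
  have heq := Set.eq_of_subset_of_ncard_le hsub (h2.trans h1) (Set.toFinite _)
  refine ⟨le_antisymm (heq ▸ h2) h1, fun i hi => ?_⟩
  by_contra! h
  rw [abs_lt] at h
  have : i ∈ {i | hA.eigenvalues i ∈ Set.Ioo (c - ε) (c + ε)} := ⟨by linarith, by linarith⟩
  rw [← heq] at this
  exact hi this

end Counting

end SGBM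

/-! ### Fourier analysis on the torus and the spectral gap. -/

namespace SGBM

open UnitAddTorus

variable {d : ℕ}

theorem norm_mFourier_apply (z : Fin d → ℤ) (x : UnitAddTorus (Fin d)) : ‖mFourier z x‖ = 1 := by
  simp only [mFourier, fourier_apply, ContinuousMap.coe_mk, norm_prod, Circle.norm_coe,
    Finset.prod_const_one]

/-- The character property makes each Fourier term of a kernel in `x - y` a rank-one product. -/
theorem mFourier_sub_apply (z : Fin d → ℤ) (x y : UnitAddTorus (Fin d)) :
    mFourier z (x - y) = mFourier z x * star (mFourier z y) := by
  simp only [mFourier, fourier_apply, ContinuousMap.coe_mk, sub_eq_add_neg, Pi.add_apply, Pi.neg_apply,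
    smul_add, smul_neg, AddCircle.toCircle_add, AddCircle.toCircle_neg, Circle.coe_mul, Circle.coe_inv_eq_conj,
    Finset.prod_mul_distrib, ← starRingEnd_apply, map_prod]

theorem integral_mFourier {z : Fin d → ℤ} (hz : z ≠ 0) :
    ∫ x, mFourier z x ∂(torusMeasure d) = 0 := by
  have h := orthonormal_iff_ite.1 (orthonormal_mFourier (d := Fin d)) 0 z
  rw [if_neg (Ne.symm hz), ContinuousMap.inner_toLp] at h
  simpa [mFourier_zero] using! h

theorem fourierCoef_eq (f : UnitAddTorus (Fin d) → ℝ) (z : Fin d → ℤ) :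
    fourierCoef f z = ∫ x, mFourier (-z) x * (f x : ℂ) ∂(torusMeasure d) := rfl

theorem fourierCoef_zero (f : UnitAddTorus (Fin d) → ℝ) : fourierCoef f 0 = density f := by
  simp [fourierCoef_eq, density, mFourier_zero, integral_complex_ofReal]

variable {f : UnitAddTorus (Fin d) → ℝ}

theorem IsConnectivity.norm_ofReal_le (hf : IsConnectivity f) (x) : ‖(f x : ℂ)‖ ≤ 1 := by
  rw [Complex.norm_real, Real.norm_eq_abs, abs_of_nonneg (hf.mem_Icc x).1]
  exact (hf.mem_Icc x).2

theorem IsConnectivity.memLp (hf : IsConnectivity f) :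
    MemLp (fun x => (f x : ℂ)) 2 (torusMeasure d) :=
  MemLp.of_bound (Complex.measurable_ofReal.comp hf.measurable).aestronglyMeasurable 1
    (Eventually.of_forall hf.norm_ofReal_le)

theorem IsConnectivity.norm_fourierCoef_le (hf : IsConnectivity f) (z : Fin d → ℤ) :
    ‖fourierCoef f z‖ ≤ 1 := by
  rw [fourierCoef_eq]
  refine (norm_integral_le_of_norm_le_const (C := 1) (Eventually.of_forall fun x => ?_)).trans ?_
  · rw [norm_mul, norm_mFourier_apply, one_mul]
    exact hf.norm_ofReal_le x
  · simp

theorem hasSum_mFourier_series (g : Lp ℂ 2 (torusMeasure d)) :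
    HasSum (fun z => mFourierCoeff g z • ContinuousMap.toLp (E := ℂ) 2 (torusMeasure d) ℂ
      (mFourier z)) g :=
  hasSum_mFourier_series_L2 g

theorem IsConnectivity.mFourierCoeff_toLp (hf : IsConnectivity f) (z : Fin d → ℤ) :
    mFourierCoeff (hf.memLp.toLp _) z = fourierCoef f z := by
  refine integral_congr_ae ?_
  filter_upwards [hf.memLp.coeFn_toLp] with x hx
  rw [hx]

/-- By Parseval the squared coefficients are summable. -/
theorem IsConnectivity.tendsto_fourierCoef (hf : IsConnectivity f) :
    Tendsto (fourierCoef f) cofinite (𝓝 0) := by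
  have h := (hasSum_sq_mFourierCoeff (hf.memLp.toLp _)).summable.tendsto_cofinite_zero
  have h2 := h.sqrt
  simp only [Real.sqrt_sq (norm_nonneg _), Real.sqrt_zero] at h2
  refine tendsto_zero_iff_norm_tendsto_zero.2 (h2.congr fun z => ?_)
  rw [← hf.mFourierCoeff_toLp]; rfl

/-- Truncated Fourier series of `f`. -/
noncomputable def partialFourier (f : UnitAddTorus (Fin d) → ℝ) (Z : Finset (Fin d → ℤ))
    (x : UnitAddTorus (Fin d)) : ℂ :=
  ∑ z ∈ Z, fourierCoef f z * mFourier z x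

theorem continuous_partialFourier (f : UnitAddTorus (Fin d) → ℝ) (Z : Finset (Fin d → ℤ)) :
    Continuous (partialFourier f Z) := by
  unfold partialFourier; fun_prop

theorem IsConnectivity.norm_partialFourier_le (hf : IsConnectivity f) (Z : Finset (Fin d → ℤ))
    (x : UnitAddTorus (Fin d)) : ‖partialFourier f Z x‖ ≤ Z.card := by
  refine (norm_sum_le _ _).trans ?_
  rw [← nsmul_one]
  refine Finset.sum_le_card_nsmul _ _ _ fun z _ => ?_
  rw [norm_mul, norm_mFourier_apply, mul_one]
  exact hf.norm_fourierCoef_le z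

/-- This is `L²` convergence of the Fourier series. Convergence along all finite sets allows one `Z`
to serve both connectivity functions and to contain `0`. -/
theorem IsConnectivity.eventually_integral_sub_partialFourier_le (hf : IsConnectivity f) {δ : ℝ}
    (hδ : 0 < δ) : ∀ᶠ Z : Finset (Fin d → ℤ) in atTop,
      ∫ x, ‖(f x : ℂ) - partialFourier f Z x‖ ^ 2 ∂(torusMeasure d) ≤ δ := by
  have h := hasSum_mFourier_series (hf.memLp.toLp _)
  have h2 : ∀ᶠ Z in atTop, dist (∑ z ∈ Z, mFourierCoeff (hf.memLp.toLp _) z •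
      ContinuousMap.toLp (E := ℂ) 2 (torusMeasure d) ℂ (mFourier z)) (hf.memLp.toLp _) < √δ :=
    (Metric.tendsto_nhds.1 h) _ (Real.sqrt_pos.2 hδ)
  filter_upwards [h2] with Z hZ
  set S : C(UnitAddTorus (Fin d), ℂ) := ⟨partialFourier f Z, continuous_partialFourier f Z⟩ with hS
  have hsum : ∑ z ∈ Z, mFourierCoeff (hf.memLp.toLp _) z •
      ContinuousMap.toLp (E := ℂ) 2 (torusMeasure d) ℂ (mFourier z)
      = ContinuousMap.toLp (E := ℂ) 2 (torusMeasure d) ℂ S := by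
    have : S = ∑ z ∈ Z, fourierCoef f z • mFourier z := by
      ext x; simp [hS, partialFourier]
    rw [this, map_sum]
    refine Finset.sum_congr rfl fun z _ => ?_
    rw [hf.mFourierCoeff_toLp, map_smul]
  rw [hsum, dist_comm, dist_eq_norm] at hZ
  set h := hf.memLp.toLp _ - ContinuousMap.toLp (E := ℂ) 2 (torusMeasure d) ℂ S with hh
  have hint : ∫ x, ‖(f x : ℂ) - partialFourier f Z x‖ ^ 2 ∂(torusMeasure d) = ‖h‖ ^ 2 := by
    have h3 : ∫ x, ‖(f x : ℂ) - partialFourier f Z x‖ ^ 2 ∂(torusMeasure d)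
        = ∫ x, ‖h x‖ ^ 2 ∂(torusMeasure d) := by
      refine integral_congr_ae ?_
      filter_upwards [Lp.coeFn_sub (hf.memLp.toLp _)
        (ContinuousMap.toLp (E := ℂ) 2 (torusMeasure d) ℂ S), hf.memLp.coeFn_toLp,
        ContinuousMap.coeFn_toLp (E := ℂ) (p := 2) (𝕜 := ℂ) (torusMeasure d) S] with x h1 h2 h3
      rw [hh, h1, Pi.sub_apply, h2, h3]
      rfl
    have h4 : ((∫ x, ‖h x‖ ^ 2 ∂(torusMeasure d) : ℝ) : ℂ) = ((‖h‖ ^ 2 : ℝ) : ℂ) := by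
      rw [← integral_complex_ofReal]
      have := L2.inner_def (𝕜 := ℂ) h h
      rw [inner_self_eq_norm_sq_to_K] at this
      simp only [inner_self_eq_norm_sq_to_K] at this
      simpa using this.symm
    rw [h3]
    exact_mod_cast h4
  rw [hint, ← Real.sq_sqrt hδ.le]
  gcongr

/-- The eigenvalues of the blocks other than the one in question stay away from it. -/
theorem exists_spectral_gap {Fi Fo : UnitAddTorus (Fin d) → ℝ} {k : ℕ} (hk : 2 ≤ k)
    (hFi : IsConnectivity Fi) (hFo : IsConnectivity Fo) (hin : density Fo < density Fi)
    (h1 : ∀ z : Fin d → ℤ,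
      fourierCoef Fi z + ((k : ℂ) - 1) * fourierCoef Fo z
        ≠ ((density Fi - density Fo : ℝ) : ℂ))
    (h2 : ∀ z : Fin d → ℤ, z ≠ 0 →
      fourierCoef Fi z - fourierCoef Fo z ≠ ((density Fi - density Fo : ℝ) : ℂ)) :
    ∃ g : ℝ, 0 < g ∧ g ≤ (density Fi - density Fo) / k ∧
      (∀ z, g ≤ ‖(fourierCoef Fi z + ((k : ℂ) - 1) * fourierCoef Fo z) / k
        - ((density Fi - density Fo) / k : ℝ)‖) ∧
      ∀ z, z ≠ 0 → g ≤ ‖(fourierCoef Fi z - fourierCoef Fo z) / k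
        - ((density Fi - density Fo) / k : ℝ)‖ := by
  set c : ℝ := (density Fi - density Fo) / k with hc
  have hk0 : (0 : ℝ) < k := by positivity
  have hcpos : 0 < c := div_pos (by linarith) hk0
  classical
  have key : ∀ (s : Set (Fin d → ℤ)) (a : (Fin d → ℤ) → ℂ), Tendsto a cofinite (𝓝 0) →
      (∀ z ∈ s, a z ≠ (density Fi - density Fo : ℝ)) →
      ∃ g : ℝ, 0 < g ∧ ∀ z ∈ s, g ≤ ‖a z / k - (c : ℝ)‖ := by
    intro s a ha hne
    -- The distances tend to `c`, so only finitely many modes are closer than `c / 2`; over these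
    -- the minimum is positive.
    have hlim : Tendsto (fun z => ‖a z / k - (c : ℝ)‖) cofinite (𝓝 c) := by
      have := ((ha.div_const (k : ℂ)).sub_const (c : ℂ)).norm
      simpa [abs_of_pos hcpos] using this
    have hev := hlim.eventually (lt_mem_nhds (half_lt_self hcpos))
    rw [eventually_cofinite] at hev
    obtain ⟨g, hg0, hg⟩ : ∃ g : ℝ, 0 < g ∧ ∀ z ∈ hev.toFinset, z ∈ s → g ≤ ‖a z / k - (c : ℝ)‖ := by
      have hpos : ∀ z ∈ hev.toFinset.filter (· ∈ s), 0 < ‖a z / k - (c : ℝ)‖ := by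
        intro z hz
        rw [norm_pos_iff, sub_ne_zero]
        intro h
        refine hne z (Finset.mem_filter.1 hz).2 ?_
        have hk0' : (k : ℂ) ≠ 0 := by exact_mod_cast hk0.ne'
        rw [div_eq_iff hk0'] at h
        rw [h, hc]
        push_cast
        field_simp
      rcases (hev.toFinset.filter (· ∈ s)).eq_empty_or_nonempty with he | hne'
      -- With no exceptional mode in `s` any positive value serves, as the minimum with `c / 2` is
      -- taken afterwards.
      · exact ⟨1, one_pos, fun z hz hs => 
          absurd (he ▸ Finset.mem_filter.2 ⟨hz, hs⟩) (Finset.notMem_empty z)⟩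
      · obtain ⟨z0, hz0, hmin⟩ := Finset.exists_min_image _ (fun z => ‖a z / k - (c : ℝ)‖) hne'
        exact ⟨_, hpos z0 hz0, fun z hz hs => hmin z (Finset.mem_filter.2 ⟨hz, hs⟩)⟩
    refine ⟨min g (c / 2), lt_min hg0 (half_pos hcpos), fun z hz => ?_⟩
    by_cases hmem : z ∈ hev.toFinset
    · exact (min_le_left _ _).trans (hg z hmem hz)
    · refine (min_le_right _ _).trans ?_
      rw [Set.Finite.mem_toFinset] at hmem
      simpa using (not_not.1 hmem).le
  obtain ⟨g1, hg1, hg1'⟩ := key Set.univ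
    (fun z => fourierCoef Fi z + ((k : ℂ) - 1) * fourierCoef Fo z)
    (by simpa using hFi.tendsto_fourierCoef.add (hFo.tendsto_fourierCoef.const_mul ((k : ℂ) - 1)))
    (fun z _ => h1 z)
  obtain ⟨g2, hg2, hg2'⟩ := key {z | z ≠ 0}
    (fun z => fourierCoef Fi z - fourierCoef Fo z)
    (by simpa using hFi.tendsto_fourierCoef.sub hFo.tendsto_fourierCoef) h2
  refine ⟨min c (min g1 g2), lt_min hcpos (lt_min hg1 hg2), min_le_left _ _, fun z => ?_,
    fun z hz => ?_⟩
  · exact ((min_le_right _ _).trans (min_le_left _ _)).trans (hg1' z trivial)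
  · exact ((min_le_right _ _).trans (min_le_right _ _)).trans (hg2' z hz)

/-- The difference of two independent uniform points is uniform. -/
theorem measurePreserving_apply_sub_apply {n : ℕ} {i j : Fin n} (hij : i ≠ j) :
    MeasurePreserving (fun X : Fin n → UnitAddTorus (Fin d) => X i - X j)
      (Measure.pi fun _ => torusMeasure d) (torusMeasure d) := by
  -- The order `(X j, X i)` matches the map `(x, y) ↦ (x, y - x)`, whose second coordinate is then
  -- `X i - X j`.
  have hpair : MeasurePreserving (fun X : Fin n → UnitAddTorus (Fin d) => (X j, X i))
      (Measure.pi fun _ => torusMeasure d) ((torusMeasure d).prod (torusMeasure d)) := by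
    refine ⟨by fun_prop, ?_⟩
    have hind := (ProbabilityTheory.iIndepFun_pi (μ := fun _ : Fin n => torusMeasure d)
      (X := fun _ => id) fun _ => aemeasurable_id).indepFun hij.symm
    have := (ProbabilityTheory.indepFun_iff_map_prod_eq_prod_map_map
      (measurable_pi_apply j).aemeasurable (measurable_pi_apply i).aemeasurable).1 hind
    refine this.trans ?_
    erw [(measurePreserving_eval (fun _ : Fin n => torusMeasure d) j).map_eq,
      (measurePreserving_eval (fun _ : Fin n => torusMeasure d) i).map_eq]
  have : (torusMeasure d).IsAddRightInvariant := by unfold torusMeasure; infer_instance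
  exact measurePreserving_snd.comp ((measurePreserving_prod_sub _ _).comp hpair)

end SGBM

namespace SGBM

/-! ### Fourth moment of the noise for independent edges. -/

section RandomGraph

open Classical in
/-- The pairs `(i, j)` with `i < j`. -/
noncomputable def orderedPairs (n : ℕ) : Finset (Fin n × Fin n) :=
  Finset.univ.filter fun q => q.1 < q.2

theorem mem_orderedPairs {n : ℕ} {q : Fin n × Fin n} : q ∈ orderedPairs n ↔ q.1 < q.2 := by
  simp [orderedPairs]

open Classical in
/-- Summing a product over pairs over all graphs factorises. -/
theorem sum_prod_adj {n : ℕ} (f g : Fin n × Fin n → ℝ) :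
    ∑ G : SimpleGraph (Fin n), ∏ q ∈ orderedPairs n, (if G.Adj q.1 q.2 then f q else g q)
      = ∏ q ∈ orderedPairs n, (f q + g q) := by
  -- The product expands over subsets of `orderedPairs n`, which are exactly the edge sets of
  -- graphs.
  rw [Finset.prod_add]
  symm
  refine Finset.sum_bij'
    (fun t _ => SimpleGraph.fromRel fun i j => (i, j) ∈ t)
    (fun G _ => (orderedPairs n).filter fun q => G.Adj q.1 q.2) (fun _ _ => Finset.mem_univ _)
    (fun G _ => Finset.mem_powerset.2 (Finset.filter_subset _ _)) ?_ ?_ ?_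
  · intro t ht
    rw [Finset.mem_powerset] at ht
    ext ⟨i, j⟩
    simp only [Finset.mem_filter, mem_orderedPairs, SimpleGraph.fromRel_adj]
    constructor
    · rintro ⟨hij, -, h | h⟩
      · exact h
      · exact absurd (mem_orderedPairs.1 (ht h)) hij.asymm
    · intro h
      have := mem_orderedPairs.1 (ht h)
      exact ⟨this, this.ne, Or.inl h⟩
  · intro G _
    ext i j
    simp only [Finset.mem_filter, mem_orderedPairs, SimpleGraph.fromRel_adj]
    constructor
    · rintro ⟨-, h | h⟩
      · exact h.2
      · exact h.2.symm
    · intro h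
      refine ⟨h.ne, ?_⟩
      rcases lt_or_gt_of_ne h.ne with h' | h'
      · exact Or.inl ⟨h', h⟩
      · exact Or.inr ⟨h', h.symm⟩
  · intro t ht
    rw [Finset.mem_powerset] at ht
    have key : ∀ q ∈ orderedPairs n, (SimpleGraph.fromRel fun i j => (i, j) ∈ t).Adj q.1 q.2
        ↔ q ∈ t := by
      rintro ⟨i, j⟩ hq
      have hij := mem_orderedPairs.1 hq
      rw [SimpleGraph.fromRel_adj]
      constructor
      · rintro ⟨-, h | h⟩
        · exact h
        · exact absurd (mem_orderedPairs.1 (ht h)) hij.asymm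
      · exact fun h => ⟨hij.ne, Or.inl h⟩
    trans ∏ q ∈ orderedPairs n, if q ∈ t then f q else g q
    · rw [Finset.prod_ite, Finset.filter_mem_eq_inter, Finset.inter_eq_right.2 ht,
        Finset.filter_notMem_eq_sdiff]
    · refine Finset.prod_congr rfl fun q hq => ?_
      by_cases h : q ∈ t
      · rw [if_pos h, if_pos ((key q hq).2 h)]
      · rw [if_neg h, if_neg (mt (key q hq).1 h)]

variable {n : ℕ} (p : Fin n × Fin n → ℝ)

open Classical in
/-- The probability of the graph `G` when the pairs `i < j` are joined independently with
probabilities `p (i, j)`. -/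
noncomputable def graphWeight (G : SimpleGraph (Fin n)) : ℝ :=
  ∏ q ∈ orderedPairs n, if G.Adj q.1 q.2 then p q else 1 - p q

open Classical in
/-- The centred entries above the diagonal of the adjacency matrix. -/
noncomputable def noise (G : SimpleGraph (Fin n)) : Matrix (Fin n) (Fin n) ℝ :=
  fun i j => if i < j then (if G.Adj i j then 1 else 0) - p (i, j) else 0

variable {p}

theorem graphWeight_nonneg (hp : ∀ q, p q ∈ Set.Icc (0 : ℝ) 1) (G : SimpleGraph (Fin n)) :
    0 ≤ graphWeight p G := by
  classical
  refine Finset.prod_nonneg fun q _ => ?_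
  split_ifs
  · exact (hp q).1
  · linarith [(hp q).2]

theorem abs_noise_le (hp : ∀ q, p q ∈ Set.Icc (0 : ℝ) 1) (G : SimpleGraph (Fin n)) (i j : Fin n) :
    |noise p G i j| ≤ 1 := by
  have := hp (i, j)
  rw [Set.mem_Icc] at this
  unfold noise
  rw [abs_le]
  split_ifs <;> constructor <;> linarith

open Classical in
theorem sum_graphWeight (p : Fin n × Fin n → ℝ) : ∑ G, graphWeight p G = 1 := by
  simp only [graphWeight]
  rw [sum_prod_adj]
  simp

-- Distinct entries are independent and centred: in the factorised sum a pair `q ∈ S` contributes `p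
-- (1 - p) + (1 - p) (-p) = 0`.
open Classical in
theorem sum_graphWeight_mul_prod_noise (p : Fin n × Fin n → ℝ) {S : Finset (Fin n × Fin n)}
    (hS : S ⊆ orderedPairs n) (hne : S.Nonempty) :
    ∑ G, graphWeight p G * ∏ q ∈ S, noise p G q.1 q.2 = 0 := by
  have key : ∀ G, graphWeight p G * ∏ q ∈ S, noise p G q.1 q.2
      = ∏ q ∈ orderedPairs n, if G.Adj q.1 q.2 then (p q * if q ∈ S then 1 - p q else 1)
        else ((1 - p q) * if q ∈ S then - p q else 1) := by
    intro G
    have h1 : ∏ q ∈ S, noise p G q.1 q.2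
        = ∏ q ∈ orderedPairs n, if q ∈ S then noise p G q.1 q.2 else 1 := by
      rw [Finset.prod_ite_mem, Finset.inter_eq_right.2 hS]
    rw [h1, graphWeight, ← Finset.prod_mul_distrib]
    refine Finset.prod_congr rfl fun q hq => ?_
    have := mem_orderedPairs.1 hq
    simp only [noise, if_pos this]
    split_ifs <;> simp
  simp only [key]
  rw [sum_prod_adj]
  obtain ⟨q, hq⟩ := hne
  refine Finset.prod_eq_zero (hS hq) ?_
  simp only [if_pos hq]
  ring

-- If all four pairs lie above the diagonal they are distinct, so the expectation vanishes by
-- independence; otherwise one entry is zero by definition.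
open Classical in
theorem sum_graphWeight_mul_four_noise (p : Fin n × Fin n → ℝ) {i j l l' : Fin n} (hij : i ≠ j)
    (hl : l ≠ l') :
    ∑ G, graphWeight p G * ((noise p G i l * noise p G j l) * (noise p G i l' * noise p G j l'))
      = 0 := by
  by_cases h : (i < l ∧ j < l) ∧ (i < l' ∧ j < l')
  · have hS := sum_graphWeight_mul_prod_noise p (S := {(i, l), (j, l), (i, l'), (j, l')})
      (by
        intro q hq
        simp only [Finset.mem_insert, Finset.mem_singleton] at hq
        rcases hq with rfl | rfl | rfl | rfl <;> rw [mem_orderedPairs] <;> simp [h])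
      (Finset.insert_nonempty _ _)
    rw [← hS]
    refine Finset.sum_congr rfl fun G _ => ?_
    rw [Finset.prod_insert, Finset.prod_insert, Finset.prod_insert, Finset.prod_singleton]
    · ring
    all_goals simp [hij, hl, hij.symm]
  · refine Finset.sum_eq_zero fun G _ => ?_
    have : ∀ a b : Fin n, ¬ a < b → noise p G a b = 0 := fun a b hab => by simp [noise, hab]
    by_cases h1 : i < l
    · by_cases h2 : j < l
      · by_cases h3 : i < l'
        · rw [this j l' (by tauto)]; ring
        · rw [this i l' h3]; ring
      · rw [this j l h2]; ring
    · rw [this i l h1]; ring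

open Classical in
/-- The fourth moment bound for the noise. -/
theorem sum_graphWeight_mul_frobenius_le (hp : ∀ q, p q ∈ Set.Icc (0 : ℝ) 1) :
    ∑ G, graphWeight p G * ∑ i, ∑ j, (noise p G * (noise p G).transpose) i j ^ 2
      ≤ 2 * (n : ℝ) ^ 3 := by
  have hexp : ∀ G i j, (noise p G * (noise p G).transpose) i j ^ 2 = ∑ l, ∑ l',
      ((noise p G i l * noise p G j l) * (noise p G i l' * noise p G j l')) := by
    intro G i j
    rw [sq, Matrix.mul_apply, Finset.sum_mul_sum]
    rfl
  have hterm : ∀ i j l l', ∑ G, graphWeight p G *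
      ((noise p G i l * noise p G j l) * (noise p G i l' * noise p G j l')) ≤ 1 := by
    intro i j l l'
    rw [← sum_graphWeight p]
    refine Finset.sum_le_sum fun G _ => mul_le_of_le_one_right (graphWeight_nonneg hp G) ?_
    refine (le_abs_self _).trans ?_
    rw [abs_mul, abs_mul, abs_mul]
    have := abs_noise_le hp G
    exact mul_le_one₀ (mul_le_one₀ (this _ _) (abs_nonneg _) (this _ _)) (by positivity)
      (mul_le_one₀ (this _ _) (abs_nonneg _) (this _ _))
  have hswap : ∑ G, graphWeight p G * ∑ i, ∑ j, (noise p G * (noise p G).transpose) i j ^ 2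
      = ∑ i, ∑ j, ∑ l, ∑ l', ∑ G, graphWeight p G *
        ((noise p G i l * noise p G j l) * (noise p G i l' * noise p G j l')) := by
    simp only [hexp, Finset.mul_sum]
    rw [Finset.sum_comm]
    refine Finset.sum_congr rfl fun i _ => ?_
    rw [Finset.sum_comm]
    refine Finset.sum_congr rfl fun j _ => ?_
    rw [Finset.sum_comm]
    refine Finset.sum_congr rfl fun l _ => ?_
    rw [Finset.sum_comm]
  rw [hswap]
  -- Only quadruples with `i = j` or `l = l'` survive, each contributing at most `1`; there are at
  -- most `2 n ^ 3` of them.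
  have hbound : ∀ i j l l', ∑ G, graphWeight p G *
      ((noise p G i l * noise p G j l) * (noise p G i l' * noise p G j l'))
      ≤ (if i = j then 1 else 0) + if l = l' then 1 else 0 := by
    intro i j l l'
    by_cases hij : i = j
    · refine (hterm i j l l').trans ?_
      rw [if_pos hij]
      split_ifs <;> norm_num
    · by_cases hl : l = l'
      · refine (hterm i j l l').trans ?_
        simp [hl, hij]
      · rw [sum_graphWeight_mul_four_noise p hij hl]
        simp [hl, hij]
  calc _ ≤ ∑ i : Fin n, ∑ j : Fin n, ∑ l : Fin n, ∑ l' : Fin n,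
        ((if i = j then (1 : ℝ) else 0) + if l = l' then 1 else 0) :=
      Finset.sum_le_sum fun i _ => Finset.sum_le_sum fun j _ => Finset.sum_le_sum fun l _ =>
        Finset.sum_le_sum fun l' _ => hbound i j l l'
    _ = _ := by
      simp [Finset.sum_add_distrib]
      ring

end RandomGraph

end SGBM

namespace SGBM

/-! ### Operator bounds from Frobenius norms. -/

section MatrixBounds

set_option linter.unusedSectionVars false

variable {a b e : Type*} [Fintype a] [DecidableEq a] [Fintype b] [DecidableEq b]
  [Fintype e] [DecidableEq e]

/-- A complex matrix as a continuous linear map between Euclidean spaces. -/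
noncomputable def euclideanMap (M : Matrix a b ℂ) : EuclideanSpace ℂ b →L[ℂ] EuclideanSpace ℂ a :=
  LinearMap.toContinuousLinearMap (Matrix.toEuclideanLin M)

theorem euclideanMap_apply (M : Matrix a b ℂ) (w : EuclideanSpace ℂ b) (i : a) :
    euclideanMap M w i = ∑ j, M i j * w j := by
  simp [euclideanMap, Matrix.mulVec, dotProduct]

theorem adjoint_euclideanMap (M : Matrix a b ℂ) :
    ContinuousLinearMap.adjoint (euclideanMap M) = euclideanMap M.conjTranspose := by
  unfold euclideanMap
  rw [Matrix.toEuclideanLin_conjTranspose_eq_adjoint, LinearMap.adjoint_toContinuousLinearMap]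

theorem euclideanMap_mul (M : Matrix a b ℂ) (N : Matrix b e ℂ) (w : EuclideanSpace ℂ e) :
    euclideanMap (M * N) w = euclideanMap M (euclideanMap N w) := by
  ext i
  simp only [euclideanMap, LinearMap.coe_toContinuousLinearMap']
  simp [Matrix.mulVec_mulVec]

theorem euclideanMap_sub (M N : Matrix a b ℂ) :
    euclideanMap (M - N) = euclideanMap M - euclideanMap N := by
  simp [euclideanMap]

theorem euclideanMap_add (M N : Matrix a b ℂ) :
    euclideanMap (M + N) = euclideanMap M + euclideanMap N := by
  simp [euclideanMap]

theorem euclideanMap_one (w : EuclideanSpace ℂ a) : euclideanMap (1 : Matrix a a ℂ) w = w := by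
  ext i
  simp [euclideanMap]

/-- The square of the Frobenius norm. -/
noncomputable def frobeniusSq (M : Matrix a b ℂ) : ℝ := ∑ i, ∑ j, ‖M i j‖ ^ 2

theorem frobeniusSq_nonneg (M : Matrix a b ℂ) : 0 ≤ frobeniusSq M :=
  Finset.sum_nonneg fun _ _ => Finset.sum_nonneg fun _ _ => sq_nonneg _

theorem norm_euclideanMap_sq_le (M : Matrix a b ℂ) (w : EuclideanSpace ℂ b) :
    ‖euclideanMap M w‖ ^ 2 ≤ frobeniusSq M * ‖w‖ ^ 2 := by
  rw [EuclideanSpace.norm_sq_eq, EuclideanSpace.norm_sq_eq, frobeniusSq, Finset.sum_mul]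
  refine Finset.sum_le_sum fun i _ => ?_
  rw [euclideanMap_apply]
  calc _ ≤ (∑ j, ‖M i j‖ * ‖w j‖) ^ 2 := by
        gcongr
        exact (norm_sum_le _ _).trans (by simp)
    _ ≤ _ := Finset.sum_mul_sq_le_sq_mul_sq _ _ _

theorem norm_euclideanMap_le {M : Matrix a b ℂ} {η : ℝ} (hη : 0 ≤ η) (hM : frobeniusSq M ≤ η ^ 2)
    (w : EuclideanSpace ℂ b) : ‖euclideanMap M w‖ ≤ η * ‖w‖ := by
  refine le_of_sq_le_sq ?_ (by positivity)
  rw [mul_pow]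
  exact (norm_euclideanMap_sq_le M w).trans (by gcongr)

/-- `‖M* w‖ ^ 2 = ⟨M M* w, w⟩`, so the Frobenius norm of `M M*` suffices. For the noise that of `M`
itself may be of order `n`, too large to be useful. -/
theorem norm_euclideanMap_conjTranspose_le {M : Matrix a b ℂ} {η : ℝ} (hη : 0 ≤ η)
    (hM : frobeniusSq (M * M.conjTranspose) ≤ η ^ 4) (w : EuclideanSpace ℂ a) :
    ‖euclideanMap M.conjTranspose w‖ ≤ η * ‖w‖ := by
  refine le_of_sq_le_sq ?_ (by positivity)
  have h1 : ‖euclideanMap (M * M.conjTranspose) w‖ ≤ η ^ 2 * ‖w‖ :=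
    norm_euclideanMap_le (by positivity) (hM.trans_eq (by ring)) w
  calc ‖euclideanMap M.conjTranspose w‖ ^ 2
      = RCLike.re (inner ℂ (euclideanMap (M * M.conjTranspose) w) w) := by
        rw [← @inner_self_eq_norm_sq ℂ, ← adjoint_euclideanMap,
          ContinuousLinearMap.adjoint_inner_right, adjoint_euclideanMap, euclideanMap_mul]
    _ ≤ ‖euclideanMap (M * M.conjTranspose) w‖ * ‖w‖ :=
        (RCLike.re_le_norm _).trans (norm_inner_le_norm _ _)
    _ ≤ η ^ 2 * ‖w‖ * ‖w‖ := by gcongr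
    _ = _ := by ring

/-- The bound for `M*` passes to `M` through `‖M w‖ ^ 2 = ⟨M* M w, w⟩`, after division by `‖M w‖`.
-/
theorem norm_euclideanMap_le_of_mul_conjTranspose {M : Matrix a b ℂ} {η : ℝ} (hη : 0 ≤ η)
    (hM : frobeniusSq (M * M.conjTranspose) ≤ η ^ 4) (w : EuclideanSpace ℂ b) :
    ‖euclideanMap M w‖ ≤ η * ‖w‖ := by
  have h := norm_euclideanMap_conjTranspose_le hη hM (euclideanMap M w)
  have h2 : ‖euclideanMap M w‖ ^ 2 ≤ η * ‖euclideanMap M w‖ * ‖w‖ := by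
    calc ‖euclideanMap M w‖ ^ 2
        = RCLike.re (inner ℂ (euclideanMap M.conjTranspose (euclideanMap M w)) w) := by
          rw [← @inner_self_eq_norm_sq ℂ, ← adjoint_euclideanMap,
            ContinuousLinearMap.adjoint_inner_left]
      _ ≤ ‖euclideanMap M.conjTranspose (euclideanMap M w)‖ * ‖w‖ :=
          (RCLike.re_le_norm _).trans (norm_inner_le_norm _ _)
      _ ≤ _ := by gcongr
  rcases (norm_nonneg (euclideanMap M w)).eq_or_lt with h0 | h0
  · rw [← h0]; positivity
  · nlinarith

end MatrixBounds

/-! ### The `k × k` blocks `α + β J`. -/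

section Block

variable {k : ℕ}

/-- Pythagoras: zero-sum vectors are orthogonal to constants. -/
theorem sum_norm_sq_mul_add {t : Fin k → ℂ} (ht : ∑ a, t a = 0) (x v : ℂ) :
    ∑ a, ‖x * t a + v‖ ^ 2 = ‖x‖ ^ 2 * ∑ a, ‖t a‖ ^ 2 + k * ‖v‖ ^ 2 := by
  have h : ∀ a, ‖x * t a + v‖ ^ 2
      = ‖x‖ ^ 2 * ‖t a‖ ^ 2 + ‖v‖ ^ 2 + 2 * RCLike.re (inner ℂ v (x * t a)) := by
    intro a
    rw [add_comm (x * t a), @norm_add_sq ℂ, norm_mul, mul_pow]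
    ring
  simp only [h, Finset.sum_add_distrib, ← Finset.mul_sum, ← map_sum, ← inner_sum, ht]
  simp

/-- The action of `α + β J` on `ℂ^k`, where `J` is the all-ones matrix. -/
theorem sum_norm_sq_block (hk : k ≠ 0) (y : Fin k → ℂ) (α β : ℂ) :
    ∑ a, ‖α * y a + β * ∑ b, y b‖ ^ 2
      = ‖α‖ ^ 2 * ∑ a, ‖y a - (∑ b, y b) / k‖ ^ 2
        + k * (‖α + k * β‖ ^ 2 * ‖(∑ b, y b) / k‖ ^ 2) := by
  have hk' : (k : ℂ) ≠ 0 := by exact_mod_cast hk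
  have ht : ∑ a, (y a - (∑ b, y b) / k) = 0 := by
    rw [Finset.sum_sub_distrib]
    simp [mul_div_cancel₀ _ hk']
  rw [← mul_pow, ← norm_mul, ← sum_norm_sq_mul_add ht]
  refine Finset.sum_congr rfl fun a _ => ?_
  congr 2
  field_simp
  ring

theorem sum_norm_sq_eq_block (hk : k ≠ 0) (y : Fin k → ℂ) :
    ∑ a, ‖y a‖ ^ 2 = ∑ a, ‖y a - (∑ b, y b) / k‖ ^ 2 + k * ‖(∑ b, y b) / k‖ ^ 2 := by
  simpa using sum_norm_sq_block hk y 1 0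

theorem sum_norm_sq_block_le (hk : k ≠ 0) (y : Fin k → ℂ) {α β : ℂ} (h1 : ‖α‖ ≤ 1)
    (h2 : ‖α + k * β‖ ≤ 1) :
    ∑ a, ‖α * y a + β * ∑ b, y b‖ ^ 2 ≤ ∑ a, ‖y a‖ ^ 2 := by
  rw [sum_norm_sq_block hk, sum_norm_sq_eq_block hk y]
  have h1' := pow_le_one₀ (n := 2) (norm_nonneg _) h1
  have h2' := pow_le_one₀ (n := 2) (norm_nonneg _) h2
  gcongr
  · exact mul_le_of_le_one_left (Finset.sum_nonneg fun _ _ => sq_nonneg _) h1'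
  · exact mul_le_of_le_one_left (sq_nonneg _) h2'

/-- A constant `y` has no zero-sum part, so `α` plays no role. This alternative serves the zero
mode, where the shifted `α` is `0`. -/
theorem le_sum_norm_sq_block (hk : k ≠ 0) (y : Fin k → ℂ) {α β : ℂ} {g : ℝ} (hg : 0 ≤ g)
    (h1 : g ≤ ‖α‖ ∨ ∀ a, y a = (∑ b, y b) / k) (h2 : g ≤ ‖α + k * β‖) :
    g ^ 2 * ∑ a, ‖y a‖ ^ 2 ≤ ∑ a, ‖α * y a + β * ∑ b, y b‖ ^ 2 := by
  rw [sum_norm_sq_block hk, sum_norm_sq_eq_block hk y, mul_add]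
  refine add_le_add ?_ ?_
  · rcases h1 with h1 | h1
    · gcongr
    · have h0 : ∀ a, y a - (∑ b, y b) / k = 0 := fun a => sub_eq_zero.2 (h1 a)
      simp only [h0]
      simp
  · rw [mul_left_comm]
    gcongr

end Block

/-! ### Sampled Fourier modes and the factorisation `U D U*`. -/

section Modes

open UnitAddTorus

variable {d k n : ℕ}

/-- The normalised vectors `e_z(X_i) 1[σ_i = a]`, for `z ∈ Z` and communities `a` of size `m`. -/
noncomputable def modeMatrix (m : ℕ) (σ : Fin n → Fin k) (Z : Finset (Fin d → ℤ))
    (X : Fin n → UnitAddTorus (Fin d)) : Matrix (Fin n) (Z × Fin k) ℂ :=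
  fun i q => if σ i = q.2 then ((√m)⁻¹ : ℝ) * mFourier q.1.1 (X i) else 0

/-- The block matrix of Fourier coefficients. -/
noncomputable def blockMatrix (k : ℕ) (Fi Fo : UnitAddTorus (Fin d) → ℝ)
    (Z : Finset (Fin d → ℤ)) : Matrix (Z × Fin k) (Z × Fin k) ℂ :=
  fun q q' => if q.1 = q'.1 then fourierCoef (if q.2 = q'.2 then Fi else Fo) q.1.1 / k else 0

/-- The edge probabilities given the positions. -/
noncomputable def edgeProb (Fi Fo : UnitAddTorus (Fin d) → ℝ) (σ : Fin n → Fin k)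
    (X : Fin n → UnitAddTorus (Fin d)) (q : Fin n × Fin n) : ℝ :=
  connect Fi Fo (X q.1 - X q.2) (σ q.1) (σ q.2)

/-- The normalised conditional expectation of the adjacency matrix given the positions. -/
noncomputable def meanMatrix (Fi Fo : UnitAddTorus (Fin d) → ℝ) (σ : Fin n → Fin k)
    (X : Fin n → UnitAddTorus (Fin d)) : Matrix (Fin n) (Fin n) ℂ :=
  fun i j => if i = j then 0 else ((edgeProb Fi Fo σ X (i, j) : ℝ) : ℂ) / n

theorem condProb_eq_graphWeight (Fi Fo : UnitAddTorus (Fin d) → ℝ) (σ : Fin n → Fin k)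
    (X : Fin n → UnitAddTorus (Fin d)) (G : SimpleGraph (Fin n)) :
    condProb Fi Fo σ X G = graphWeight (edgeProb Fi Fo σ X) G := by
  rfl

variable {Fi Fo : UnitAddTorus (Fin d) → ℝ}

theorem edgeProb_mem_Icc (hFi : IsConnectivity Fi) (hFo : IsConnectivity Fo) (σ : Fin n → Fin k)
    (X : Fin n → UnitAddTorus (Fin d)) (q : Fin n × Fin n) :
    edgeProb Fi Fo σ X q ∈ Set.Icc (0 : ℝ) 1 := by
  unfold edgeProb connect
  split_ifs
  · exact hFi.mem_Icc _
  · exact hFo.mem_Icc _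

theorem edgeProb_swap (hFi : IsConnectivity Fi) (hFo : IsConnectivity Fo) (σ : Fin n → Fin k)
    (X : Fin n → UnitAddTorus (Fin d)) (i j : Fin n) :
    edgeProb Fi Fo σ X (i, j) = edgeProb Fi Fo σ X (j, i) := by
  unfold edgeProb connect
  simp only [eq_comm (a := σ i)]
  rw [← neg_sub (X j) (X i), hFi.even, hFo.even]

theorem blockMatrix_apply (Z : Finset (Fin d → ℤ)) (y : EuclideanSpace ℂ (Z × Fin k))
    (z : Z) (a : Fin k) :
    euclideanMap (blockMatrix k Fi Fo Z) y (z, a)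
      = (fourierCoef Fi z - fourierCoef Fo z) / k * y (z, a)
        + fourierCoef Fo z / k * ∑ b, y (z, b) := by
  rw [euclideanMap_apply, Fintype.sum_prod_type, Finset.sum_eq_single z]
  · have h : ∀ b, blockMatrix k Fi Fo Z (z, a) (z, b) * y (z, b)
        = (if a = b then (fourierCoef Fi z - fourierCoef Fo z) / k * y (z, b) else 0)
          + fourierCoef Fo z / k * y (z, b) := by
      intro b
      simp only [blockMatrix, if_true]
      split_ifs <;> ring
    simp only [h, Finset.sum_add_distrib, ← Finset.mul_sum]
    simp
  · intro w _ hw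
    simp [blockMatrix, hw.symm]
  · simp

theorem norm_sq_eq_sum_blocks (Z : Finset (Fin d → ℤ)) (y : EuclideanSpace ℂ (Z × Fin k)) :
    ‖y‖ ^ 2 = ∑ z, ∑ a, ‖y (z, a)‖ ^ 2 := by
  rw [EuclideanSpace.norm_sq_eq, Fintype.sum_prod_type]

/-- Both block eigenvalues have modulus at most `1`: one is at most `2 / k`, where `k ≥ 2` enters,
and the other averages `k` coefficients. -/
theorem norm_blockMatrix_le (hk : 2 ≤ k) (hFi : IsConnectivity Fi) (hFo : IsConnectivity Fo)
    (Z : Finset (Fin d → ℤ)) (y : EuclideanSpace ℂ (Z × Fin k)) :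
    ‖euclideanMap (blockMatrix k Fi Fo Z) y‖ ≤ ‖y‖ := by
  refine le_of_sq_le_sq ?_ (norm_nonneg _)
  rw [norm_sq_eq_sum_blocks, norm_sq_eq_sum_blocks]
  have hk0 : (0 : ℝ) < k := by positivity
  have hk0' : (k : ℂ) ≠ 0 := by exact_mod_cast hk0.ne'
  have hk2 : (2 : ℝ) ≤ k := by exact_mod_cast hk
  refine Finset.sum_le_sum fun z _ => ?_
  simp only [blockMatrix_apply]
  have hi := hFi.norm_fourierCoef_le z
  have ho := hFo.norm_fourierCoef_le z
  refine sum_norm_sq_block_le (by omega) (fun a => y (z, a)) ?_ ?_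
  · rw [norm_div, Complex.norm_natCast, div_le_one hk0]
    exact (norm_sub_le _ _).trans (by linarith)
  · have : (fourierCoef Fi z - fourierCoef Fo z) / k + k * (fourierCoef Fo z / k)
        = (fourierCoef Fi z + ((k : ℂ) - 1) * fourierCoef Fo z) / k := by
      field_simp; ring
    rw [this, norm_div, Complex.norm_natCast, div_le_one hk0]
    have h1 : ‖(k : ℂ) - 1‖ = (k : ℝ) - 1 := by
      rw [← Complex.ofReal_natCast, ← Complex.ofReal_one, ← Complex.ofReal_sub, Complex.norm_real,
        Real.norm_eq_abs, abs_of_nonneg (by linarith)]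
    calc _ ≤ ‖fourierCoef Fi z‖ + ‖((k : ℂ) - 1) * fourierCoef Fo z‖ := norm_add_le _ _
      _ ≤ 1 + ((k : ℝ) - 1) * 1 := by
        rw [norm_mul, h1]
        gcongr
        linarith
      _ = _ := by ring

/-- The condition `hy` removes from the zero mode its zero-sum part, where in the application the
eigenvalue is `c` itself. -/
theorem le_norm_blockMatrix_sub (hk : 2 ≤ k) (Z : Finset (Fin d → ℤ)) {g c : ℝ} (hg : 0 ≤ g)
    (h1 : ∀ z, g ≤ ‖(fourierCoef Fi z + ((k : ℂ) - 1) * fourierCoef Fo z) / k - (c : ℂ)‖)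
    (h2 : ∀ z, z ≠ 0 → g ≤ ‖(fourierCoef Fi z - fourierCoef Fo z) / k - (c : ℂ)‖)
    (y : EuclideanSpace ℂ (Z × Fin k)) (hy : ∀ z : Z, z.1 = 0 → ∀ a b, y (z, a) = y (z, b)) :
    g * ‖y‖ ≤ ‖euclideanMap (blockMatrix k Fi Fo Z) y - (c : ℂ) • y‖ := by
  refine le_of_sq_le_sq ?_ (norm_nonneg _)
  rw [mul_pow, norm_sq_eq_sum_blocks, norm_sq_eq_sum_blocks, Finset.mul_sum]
  have hk0' : (k : ℂ) ≠ 0 := by exact_mod_cast (by omega : k ≠ 0)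
  refine Finset.sum_le_sum fun z _ => ?_
  have h : ∀ a, (euclideanMap (blockMatrix k Fi Fo Z) y - (c : ℂ) • y) (z, a)
      = ((fourierCoef Fi z - fourierCoef Fo z) / k - c) * y (z, a)
        + fourierCoef Fo z / k * ∑ b, y (z, b) := by
    intro a
    rw [PiLp.sub_apply, PiLp.smul_apply, blockMatrix_apply, smul_eq_mul]
    ring
  simp only [h]
  refine le_sum_norm_sq_block (by omega) (fun a => y (z, a)) hg ?_ ?_
  · by_cases hz : z.1 = 0
    · right
      intro a
      have := hy z hz
      rw [Finset.sum_congr rfl fun b _ => this b a]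
      simp [mul_div_cancel_left₀ _ hk0']
    · exact Or.inl (h2 _ hz)
  · refine (h1 z).trans_eq ?_
    congr 1
    field_simp
    ring

/-- The matrix `U D U*` is the truncated Fourier series of the connectivity functions. -/
theorem modeMatrix_mul_blockMatrix_mul (m : ℕ) (σ : Fin n → Fin k) (Z : Finset (Fin d → ℤ))
    (X : Fin n → UnitAddTorus (Fin d)) (i j : Fin n) :
    (modeMatrix m σ Z X * blockMatrix k Fi Fo Z * (modeMatrix m σ Z X).conjTranspose) i j
      = partialFourier (if σ i = σ j then Fi else Fo) Z (X i - X j) / (k * m) := by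
  have hs : (((√(m : ℝ))⁻¹ : ℝ) : ℂ) * (((√(m : ℝ))⁻¹ : ℝ) : ℂ) = (m : ℂ)⁻¹ := by
    rw [← Complex.ofReal_mul, ← mul_inv, Real.mul_self_sqrt (Nat.cast_nonneg _)]
    simp
  rw [Matrix.mul_apply]
  simp only [Matrix.mul_apply, Fintype.sum_prod_type, Matrix.conjTranspose_apply]
  simp only [modeMatrix, blockMatrix, ite_mul, zero_mul, mul_ite, mul_zero, Finset.sum_ite_eq,
    Finset.mem_univ, if_true, Finset.sum_ite_irrel, Finset.sum_const_zero, Finset.sum_ite_eq',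
    apply_ite (star : ℂ → ℂ), star_zero, partialFourier]
  rw [Finset.sum_div, ← Finset.sum_coe_sort Z]
  refine Finset.sum_congr rfl fun z _ => ?_
  rw [mFourier_sub_apply, star_mul', ← starRingEnd_apply, Complex.conj_ofReal, div_eq_mul_inv _ ((k : ℂ) * m),
    mul_inv, ← hs]
  ring

end Modes

end SGBM

namespace SGBM

/-! ### The cluster is isolated once the errors are small. -/

section Deterministic

open UnitAddTorus

variable {d k n : ℕ} {Fi Fo : UnitAddTorus (Fin d) → ℝ}

theorem IsConnectivity.density_nonneg {f : UnitAddTorus (Fin d) → ℝ} (hf : IsConnectivity f) :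
    0 ≤ density f :=
  integral_nonneg fun x => (hf.mem_Icc x).1

theorem IsConnectivity.density_le_one {f : UnitAddTorus (Fin d) → ℝ} (hf : IsConnectivity f) :
    density f ≤ 1 := by
  have h := hf.norm_fourierCoef_le 0
  rwa [fourierCoef_zero, Complex.norm_real, Real.norm_eq_abs,
    abs_of_nonneg hf.density_nonneg] at h

/-- Real vectors as complex vectors. -/
noncomputable def complexify (w : EuclideanSpace ℝ (Fin n)) : EuclideanSpace ℂ (Fin n) :=
  WithLp.toLp 2 fun i => (w i : ℂ)

theorem norm_complexify (w : EuclideanSpace ℝ (Fin n)) : ‖complexify w‖ = ‖w‖ := by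
  simp [complexify, EuclideanSpace.norm_eq]

open Classical in
/-- The adjacency matrix divided by the number of vertices. -/
noncomputable def scaledAdj (G : SimpleGraph (Fin n)) : Matrix (Fin n) (Fin n) ℂ :=
  fun i j => ((G.adjMatrix ℝ i j : ℝ) : ℂ) / n

-- Eigenvalues are counted over `ℝ` while the modes are complex; only norms are compared, and these
-- survive complexification.
open Classical in
theorem norm_scaledAdj_sub (hn : n ≠ 0) (G : SimpleGraph (Fin n)) (c : ℝ)
    (w : EuclideanSpace ℝ (Fin n)) :
    ‖Matrix.toEuclideanLin (G.adjMatrix ℝ) w - (c * n) • w‖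
      = n * ‖euclideanMap (scaledAdj G) (complexify w) - (c : ℂ) • complexify w‖ := by
  have hn0 : (n : ℂ) ≠ 0 := by exact_mod_cast hn
  have h : complexify (Matrix.toEuclideanLin (G.adjMatrix ℝ) w - (c * n) • w)
      = (n : ℂ) • (euclideanMap (scaledAdj G) (complexify w) - (c : ℂ) • complexify w) := by
    ext i
    rw [PiLp.smul_apply, PiLp.sub_apply, PiLp.smul_apply, euclideanMap_apply]
    simp only [complexify, scaledAdj, PiLp.sub_apply, PiLp.smul_apply, smul_eq_mul, mul_sub,
      Finset.mul_sum]
    push_cast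
    congr 1
    · simp only [Matrix.toEuclideanLin, Matrix.toLpLin_apply, Matrix.mulVec, dotProduct]
      push_cast
      refine Finset.sum_congr rfl fun j _ => ?_
      field_simp
    · ring
  rw [← norm_complexify, h, norm_smul, Complex.norm_natCast]

/-- The decomposition of the scaled adjacency matrix into mean and noise. -/
theorem scaledAdj_eq (hFi : IsConnectivity Fi) (hFo : IsConnectivity Fo) (σ : Fin n → Fin k)
    (X : Fin n → UnitAddTorus (Fin d)) (G : SimpleGraph (Fin n)) :
    scaledAdj G = meanMatrix Fi Fo σ X
      + ((n : ℂ)⁻¹ • (noise (edgeProb Fi Fo σ X) G).map Complex.ofReal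
        + ((n : ℂ)⁻¹ • (noise (edgeProb Fi Fo σ X) G).map Complex.ofReal).conjTranspose) := by
  ext i j
  simp only [scaledAdj, meanMatrix, Matrix.add_apply, Matrix.smul_apply, Matrix.map_apply,
    Matrix.conjTranspose_apply, noise, SimpleGraph.adjMatrix_apply, smul_eq_mul]
  rcases lt_trichotomy i j with h | rfl | h
  · simp only [h.ne, h, h.not_gt, if_true, if_false]
    simp
    split_ifs <;> simp <;> ring
  · simp
  · simp only [h.ne', h, h.not_gt, if_true, if_false, edgeProb_swap hFi hFo σ X i j]
    by_cases hadj : G.Adj i j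
    · simp [hadj, hadj.symm]
      ring
    · have hadj' : ¬ G.Adj j i := fun h => hadj h.symm
      simp [hadj, hadj']
      ring

/-- Vectors of community weights with zero sum. -/
noncomputable def zeroSum (k : ℕ) : Submodule ℝ (Fin k → ℝ) :=
  LinearMap.ker (∑ a, LinearMap.proj a : (Fin k → ℝ) →ₗ[ℝ] ℝ)

theorem mem_zeroSum {b : Fin k → ℝ} : b ∈ zeroSum k ↔ ∑ a, b a = 0 := by
  simp [zeroSum]

theorem finrank_zeroSum (hk : 2 ≤ k) : Module.finrank ℝ (zeroSum k) = k - 1 := by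
  set φ : (Fin k → ℝ) →ₗ[ℝ] ℝ := ∑ a, LinearMap.proj a with hφ
  have hr : LinearMap.range φ = ⊤ := by
    apply LinearMap.range_eq_top.2
    apply LinearMap.surjective
    intro h
    have := LinearMap.congr_fun h (Pi.single ⟨0, by omega⟩ 1)
    simp [hφ] at this
  have := LinearMap.finrank_range_add_finrank_ker φ
  rw [hr, finrank_top, Module.finrank_self, Module.finrank_fin_fun] at this
  have h2 : Module.finrank ℝ (zeroSum k) = Module.finrank ℝ (LinearMap.ker φ) := rfl
  omega

/-- The vector that is constant on communities. -/
noncomputable def communityVector (σ : Fin n → Fin k) :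
    zeroSum k →ₗ[ℝ] EuclideanSpace ℝ (Fin n) where
  toFun b := WithLp.toLp 2 fun i => b.1 (σ i)
  map_add' _ _ := rfl
  map_smul' _ _ := rfl

/-- The pairing of a vector with the community vectors. -/
noncomputable def communityPairing (σ : Fin n → Fin k) :
    EuclideanSpace ℝ (Fin n) →ₗ[ℝ] Module.Dual ℝ (zeroSum k) where
  toFun w :=
    { toFun := fun b => ∑ i, w i * b.1 (σ i)
      map_add' := fun _ _ => by simp [mul_add, Finset.sum_add_distrib]
      map_smul' := fun _ _ => by simp [Finset.mul_sum, mul_left_comm] }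
  map_add' _ _ := by
    ext; simp [add_mul, Finset.sum_add_distrib]
  map_smul' _ _ := by
    ext; simp [Finset.mul_sum, mul_assoc]

/-- The coordinates of a community vector with respect to the modes. -/
noncomputable def modeVector (m : ℕ) (Z : Finset (Fin d → ℤ)) (b : Fin k → ℝ) :
    EuclideanSpace ℂ (Z × Fin k) :=
  WithLp.toLp 2 fun q => if q.1.1 = 0 then ((√m * b q.2 : ℝ) : ℂ) else 0

theorem modeMatrix_modeVector {m : ℕ} (hm : m ≠ 0) (σ : Fin n → Fin k) {Z : Finset (Fin d → ℤ)}
    (hZ : (0 : Fin d → ℤ) ∈ Z) (X : Fin n → UnitAddTorus (Fin d)) (b : zeroSum k) :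
    euclideanMap (modeMatrix m σ Z X) (modeVector m Z b.1)
      = complexify (communityVector σ b) := by
  have hm0 : √(m : ℝ) ≠ 0 := by positivity
  ext i
  rw [euclideanMap_apply, Fintype.sum_prod_type, Finset.sum_eq_single ⟨0, hZ⟩]
  · simp only [modeMatrix, modeVector, mFourier_zero, if_true, ite_mul, zero_mul,
      Finset.sum_ite_eq, Finset.mem_univ, complexify,
      ContinuousMap.one_apply, mul_one]
    rw [← Complex.ofReal_mul, inv_mul_cancel_left₀ hm0]
    rfl
  · intro z _ hz
    have : z.1 ≠ 0 := fun h => hz (Subtype.ext h)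
    simp [modeVector, this]
  · simp

theorem blockMatrix_modeVector (m : ℕ) (Z : Finset (Fin d → ℤ)) {b : Fin k → ℝ}
    (hb : b ∈ zeroSum k) :
    euclideanMap (blockMatrix k Fi Fo Z) (modeVector m Z b)
      = (((density Fi - density Fo) / k : ℝ) : ℂ) • modeVector m Z b := by
  ext ⟨z, a⟩
  rw [blockMatrix_apply, PiLp.smul_apply, smul_eq_mul]
  by_cases hz : z.1 = 0
  · have : ∑ c, modeVector m Z b (z, c) = 0 := by
      simp only [modeVector, hz, if_true]
      rw [← Complex.ofReal_sum, ← Finset.mul_sum, mem_zeroSum.1 hb]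
      simp
    rw [this, hz, fourierCoef_zero, fourierCoef_zero]
    simp
  · simp [modeVector, hz]

/-- The zero mode of a vector orthogonal to the community vectors does not depend on the
community. -/
theorem conjTranspose_modeMatrix_eq (m : ℕ) (σ : Fin n → Fin k) (Z : Finset (Fin d → ℤ))
    (X : Fin n → UnitAddTorus (Fin d)) {w : EuclideanSpace ℝ (Fin n)}
    (hw : communityPairing σ w = 0) (z : Z) (hz : z.1 = 0) (a b : Fin k) :
    euclideanMap (modeMatrix m σ Z X).conjTranspose (complexify w) (z, a)
      = euclideanMap (modeMatrix m σ Z X).conjTranspose (complexify w) (z, b) := by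
  have hs : ∀ a, euclideanMap (modeMatrix m σ Z X).conjTranspose (complexify w) (z, a)
      = (((√m)⁻¹ : ℝ) : ℂ) * ((∑ i, w i * (Pi.single a 1 : Fin k → ℝ) (σ i) : ℝ) : ℂ) := by
    intro a
    rw [euclideanMap_apply]
    push_cast
    rw [Finset.mul_sum]
    refine Finset.sum_congr rfl fun i _ => ?_
    simp only [Matrix.conjTranspose_apply, modeMatrix, hz, mFourier_zero, complexify,
      Pi.single_apply]
    split_ifs <;> simp
  -- Since `e_0 = 1`, the zero mode on a community is a plain sum over it; pairing with the
  -- difference of two indicators gives exact equality.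
  have hmem : (Pi.single a 1 - Pi.single b 1 : Fin k → ℝ) ∈ zeroSum k := by
    rw [mem_zeroSum]; simp
  have h0 := LinearMap.congr_fun hw ⟨_, hmem⟩
  have h1 : ∑ i, w i * (Pi.single a 1 : Fin k → ℝ) (σ i)
      = ∑ i, w i * (Pi.single b 1 : Fin k → ℝ) (σ i) := by
    rw [← sub_eq_zero, ← Finset.sum_sub_distrib]
    simpa [communityPairing, mul_sub] using h0
  rw [hs, hs, h1]

/-- The deterministic part of the theorem: if the normalised modes are almost orthonormal and the
adjacency matrix is close to the truncated Fourier series, the cluster is isolated. -/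
theorem isolatedCluster_of_frobenius {m : ℕ} (hk : 2 ≤ k) (hm : m ≠ 0) (hn : n ≠ 0)
    (hFi : IsConnectivity Fi) (hFo : IsConnectivity Fo) {g η τ : ℝ}
    (hg : 0 < g) (hgc : g ≤ (density Fi - density Fo) / k)
    (hg1 : ∀ z, g ≤ ‖(fourierCoef Fi z + ((k : ℂ) - 1) * fourierCoef Fo z) / k
        - ((density Fi - density Fo) / k : ℝ)‖)
    (hg2 : ∀ z, z ≠ 0 → g ≤ ‖(fourierCoef Fi z - fourierCoef Fo z) / k
        - ((density Fi - density Fo) / k : ℝ)‖)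
    (hη : 0 < η) (hηg : η ≤ g ^ 2 / 16) (hητ : 5 * η < τ) (hτ : τ < g / 4)
    (σ : Fin n → Fin k) {Z : Finset (Fin d → ℤ)} (hZ : (0 : Fin d → ℤ) ∈ Z)
    (X : Fin n → UnitAddTorus (Fin d)) (G : SimpleGraph (Fin n))
    (h1 : frobeniusSq ((modeMatrix m σ Z X).conjTranspose * modeMatrix m σ Z X - 1) ≤ η ^ 2)
    (h2 : frobeniusSq (meanMatrix Fi Fo σ X - modeMatrix m σ Z X * blockMatrix k Fi Fo Z
      * (modeMatrix m σ Z X).conjTranspose) ≤ (η / 3) ^ 2)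
    (h3 : ∑ i, ∑ j, (noise (edgeProb Fi Fo σ X) G
      * (noise (edgeProb Fi Fo σ X) G).transpose) i j ^ 2 ≤ (n * (η / 3)) ^ 4) :
    IsolatedCluster G (n * (density Fi - density Fo) / k) τ (g / 4) (k - 1) := by
  classical
  set c : ℝ := (density Fi - density Fo) / k with hc
  set U := modeMatrix m σ Z X
  set D := blockMatrix k Fi Fo Z
  have hk0 : (0 : ℝ) < k := by positivity
  have hn0 : (0 : ℝ) < n := by positivity
  have hc1 : c ≤ 1 := by
    have hi := hFi.density_le_one
    have ho := hFo.density_nonneg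
    have hk2 : (2 : ℝ) ≤ k := by exact_mod_cast hk
    rw [hc, div_le_one hk0]
    linarith
  have hgle : g ≤ 1 := hgc.trans hc1
  have hU : ∀ y, ‖ContinuousLinearMap.adjoint (euclideanMap U) (euclideanMap U y) - y‖
      ≤ η * ‖y‖ := by
    intro y
    have := norm_euclideanMap_le hη.le h1 y
    rwa [euclideanMap_sub, sub_apply, euclideanMap_mul, euclideanMap_one,
      ← adjoint_euclideanMap] at this
  set L : Matrix (Fin n) (Fin n) ℂ :=
    (n : ℂ)⁻¹ • (noise (edgeProb Fi Fo σ X) G).map Complex.ofReal with hL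
  have hLf : frobeniusSq (L * L.conjTranspose) ≤ (η / 3) ^ 4 := by
    have he : ∀ i j, ‖(L * L.conjTranspose) i j‖ ^ 2 = ((noise (edgeProb Fi Fo σ X) G
        * (noise (edgeProb Fi Fo σ X) G).transpose) i j ^ 2) / (n : ℝ) ^ 4 := by
      intro i j
      have : (L * L.conjTranspose) i j = (((noise (edgeProb Fi Fo σ X) G
          * (noise (edgeProb Fi Fo σ X) G).transpose) i j / (n : ℝ) ^ 2 : ℝ) : ℂ) := by
        simp only [hL, Matrix.mul_apply, Matrix.conjTranspose_apply, Matrix.smul_apply,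
          Matrix.map_apply, Matrix.transpose_apply, smul_eq_mul, Finset.sum_div]
        push_cast
        refine Finset.sum_congr rfl fun l _ => ?_
        simp
        field_simp
      rw [this, Complex.norm_real, Real.norm_eq_abs, sq_abs, div_pow]
      ring
    unfold frobeniusSq
    simp only [he, ← Finset.sum_div]
    rw [div_le_iff₀ (by positivity)]
    exact h3.trans_eq (by ring)
  -- The budget `η` is shared equally by the truncated mean, `L` and `L*`.
  have hT : ∀ w, ‖euclideanMap (scaledAdj G) w
      - euclideanMap U (euclideanMap D (ContinuousLinearMap.adjoint (euclideanMap U) w))‖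
      ≤ η * ‖w‖ := by
    intro w
    have e1 := norm_euclideanMap_le (by positivity) h2 w
    have e2 := norm_euclideanMap_le_of_mul_conjTranspose (by positivity) hLf w
    have e3 := norm_euclideanMap_conjTranspose_le (by positivity) hLf w
    rw [euclideanMap_sub, sub_apply, euclideanMap_mul, euclideanMap_mul,
      ← adjoint_euclideanMap] at e1
    rw [scaledAdj_eq hFi hFo σ X G, ← hL, euclideanMap_add, euclideanMap_add,
      add_apply, add_apply, add_sub_right_comm]
    refine (norm_add_le _ _).trans ((add_le_add e1 (norm_add_le _ _)).trans ?_)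
    linarith
  have hD := norm_blockMatrix_le hk hFi hFo Z
  have hmain := isolated_eigenvalues (adjMatrix_isHermitian G) (communityVector σ)
    (communityPairing σ) (c := c * n) (τ := τ * n) (ε := g / 4 * n) (finrank_zeroSum hk)
    ((Subspace.dual_finrank_eq).trans (finrank_zeroSum hk)) (by gcongr) ?_ ?_
  · have hcn : (n : ℝ) * (density Fi - density Fo) / k = c * n := by rw [hc]; ring
    rw [IsolatedCluster, hcn]
    exact hmain
  · intro b hb
    have hη34 : η ≤ 3 / 4 := by nlinarith
    obtain ⟨e1, e2⟩ := norm_sub_smul_le_of_eigenvector (euclideanMap U) (euclideanMap D)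
      (euclideanMap (scaledAdj G)) hη34 hη.le hU hT hD (blockMatrix_modeVector m Z b.2)
    rw [modeMatrix_modeVector hm σ hZ X b] at e1 e2
    rw [norm_scaledAdj_sub hn, mul_right_comm τ]
    rw [norm_complexify] at e1 e2
    have hpos : 0 < ‖communityVector σ b‖ := by
      have : modeVector m Z b.1 ≠ 0 := by
        intro h
        refine hb (Subtype.ext (funext fun a => ?_))
        have h' := congrArg (fun v : EuclideanSpace ℂ (Z × Fin k) => v (⟨0, hZ⟩, a)) h
        have hm0 : √(m : ℝ) ≠ 0 := by positivity
        simpa [modeVector, hm0, hm] using h'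
      have := norm_pos_iff.2 this
      linarith
    have e3 : 5 * η * ‖communityVector σ b‖ < τ * ‖communityVector σ b‖ := by gcongr
    rw [mul_comm]
    have := e1.trans_lt e3
    gcongr
  · intro w hw
    have := le_norm_sub_smul_of_gap (euclideanMap U) (euclideanMap D)
      (euclideanMap (scaledAdj G)) hg hgc hc1 hηg hη.le hU hT hD (w := complexify w) (by
        rw [adjoint_euclideanMap]
        exact le_norm_blockMatrix_sub hk Z hg.le hg1 hg2 _
          fun z hz a b => conjTranspose_modeMatrix_eq m σ Z X hw z hz a b)
    rw [norm_complexify] at this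
    rw [norm_scaledAdj_sub hn, mul_right_comm, mul_comm]
    gcongr

end Deterministic

end SGBM

namespace SGBM

/-! ### Averaging over positions and graphs. -/

section Random

open UnitAddTorus

variable {d k n : ℕ} {Fi Fo : UnitAddTorus (Fin d) → ℝ}

/-- The law of the positions. -/
noncomputable abbrev positions (d n : ℕ) : Measure (Fin n → UnitAddTorus (Fin d)) :=
  Measure.pi fun _ => torusMeasure d

theorem integrable_of_continuous {E : Type*} [NormedAddCommGroup E]
    {f : (Fin n → UnitAddTorus (Fin d)) → E} (hf : Continuous f) : Integrable f (positions d n) :=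
  hf.integrable_of_hasCompactSupport (HasCompactSupport.of_compactSpace _)

theorem integral_mFourier_sub {u : Fin d → ℤ} (hu : u ≠ 0) (i j : Fin n) :
    ∫ X, mFourier u (X i - X j) ∂(positions d n) = if i = j then 1 else 0 := by
  split_ifs with h
  · subst h
    simp [mFourier]
  · rw [← integral_mFourier hu, ← (measurePreserving_apply_sub_apply h).map_eq, integral_map]
    · exact (measurePreserving_apply_sub_apply h).measurable.aemeasurable
    · exact (mFourier u).continuous.aestronglyMeasurable

/-- In the expanded square the terms with `i ≠ j` have mean zero, as `X i - X j` is uniform and `u ≠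
0`; the diagonal terms are `1`. -/
theorem integral_norm_sq_sum_mFourier {u : Fin d → ℤ} (hu : u ≠ 0) (S : Finset (Fin n)) :
    ∫ X, ‖∑ i ∈ S, mFourier u (X i)‖ ^ 2 ∂(positions d n) = S.card := by
  have h : ∀ X : Fin n → UnitAddTorus (Fin d), ((‖∑ i ∈ S, mFourier u (X i)‖ ^ 2 : ℝ) : ℂ)
      = ∑ i ∈ S, ∑ j ∈ S, mFourier u (X i - X j) := by
    intro X
    rw [Complex.ofReal_pow, ← Complex.mul_conj', map_sum, Finset.sum_mul_sum]
    simp only [mFourier_sub_apply]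
    rfl
  have hint : ∀ i j, Integrable (fun X : Fin n → UnitAddTorus (Fin d) => mFourier u (X i - X j))
      (positions d n) := fun i j => integrable_of_continuous (by fun_prop)
  have : ((∫ X, ‖∑ i ∈ S, mFourier u (X i)‖ ^ 2 ∂(positions d n) : ℝ) : ℂ) = (S.card : ℝ) := by
    rw [← integral_complex_ofReal]
    simp only [h]
    rw [integral_finsetSum _ fun i _ => integrable_finsetSum _ fun j _ => hint i j]
    simp_rw [integral_finsetSum _ fun j _ => hint _ j, integral_mFourier_sub hu]
    simp
  exact_mod_cast this

/-- The deviation of the normalised modes from orthonormality. -/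
noncomputable def gramError (m : ℕ) (σ : Fin n → Fin k) (Z : Finset (Fin d → ℤ))
    (X : Fin n → UnitAddTorus (Fin d)) : Matrix (Z × Fin k) (Z × Fin k) ℂ :=
  (modeMatrix m σ Z X).conjTranspose * modeMatrix m σ Z X - 1

theorem continuous_modeMatrix_apply (m : ℕ) (σ : Fin n → Fin k) (Z : Finset (Fin d → ℤ)) (i : Fin n)
    (q : Z × Fin k) : Continuous fun X => modeMatrix m σ Z X i q := by
  unfold modeMatrix
  split_ifs <;> fun_prop

theorem continuous_gram_apply (m : ℕ) (σ : Fin n → Fin k) (Z : Finset (Fin d → ℤ))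
    (q q' : Z × Fin k) : Continuous fun X =>
      gramError m σ Z X q q' := by
  simp only [gramError, Matrix.sub_apply, Matrix.mul_apply, Matrix.conjTranspose_apply]
  have := continuous_modeMatrix_apply m σ Z
  fun_prop

/-- Different communities have disjoint supports, and size `m` makes each column exactly of norm
one. What remains are distinct modes on one community. -/
theorem gram_apply {m : ℕ} (hm : m ≠ 0) (σ : Fin n → Fin k)
    (hσ : ∀ a, (Finset.univ.filter fun i => σ i = a).card = m) (Z : Finset (Fin d → ℤ))
    (X : Fin n → UnitAddTorus (Fin d)) (q q' : Z × Fin k) :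
    gramError m σ Z X q q'
      = if q.2 = q'.2 ∧ q.1 ≠ q'.1 then
          (m : ℂ)⁻¹ * ∑ i ∈ Finset.univ.filter fun i => σ i = q.2, mFourier (q'.1.1 - q.1.1) (X i)
        else 0 := by
  have hs : (((√(m : ℝ))⁻¹ : ℝ) : ℂ) * (((√(m : ℝ))⁻¹ : ℝ) : ℂ) = (m : ℂ)⁻¹ := by
    rw [← Complex.ofReal_mul, ← mul_inv, Real.mul_self_sqrt (Nat.cast_nonneg _)]
    simp
  have hgram : ((modeMatrix m σ Z X).conjTranspose * modeMatrix m σ Z X) q q'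
      = if q.2 = q'.2 then
          (m : ℂ)⁻¹ * ∑ i ∈ Finset.univ.filter fun i => σ i = q.2, mFourier (q'.1.1 - q.1.1) (X i)
        else 0 := by
    rw [Matrix.mul_apply]
    split_ifs with h
    · rw [Finset.mul_sum, Finset.sum_filter]
      refine Finset.sum_congr rfl fun i _ => ?_
      simp only [Matrix.conjTranspose_apply, modeMatrix, ← h]
      split_ifs
      · rw [sub_eq_add_neg, mFourier_add, mFourier_neg, star_mul', ← starRingEnd_apply,
          ← starRingEnd_apply, Complex.conj_ofReal, ← hs]
        ring
      · simp
    · refine Finset.sum_eq_zero fun i _ => ?_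
      simp only [Matrix.conjTranspose_apply, modeMatrix]
      split_ifs with h1 h2
      · exact absurd (h1.symm.trans h2) h
      all_goals simp
  rw [gramError, Matrix.sub_apply, hgram, Matrix.one_apply]
  have hm0 : (m : ℂ) ≠ 0 := by exact_mod_cast hm
  by_cases h2 : q.2 = q'.2
  · by_cases h1 : q.1 = q'.1
    · simp [h1, h2, Prod.ext_iff, mFourier_zero, hσ, hm0]
    · simp [h1, h2, Prod.ext_iff]
  · simp [h2, Prod.ext_iff]

theorem integrable_frobeniusSq_gram (m : ℕ) (σ : Fin n → Fin k) (Z : Finset (Fin d → ℤ)) :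
    Integrable (fun X => frobeniusSq (gramError m σ Z X))
      (positions d n) := by
  unfold frobeniusSq
  exact integrable_finsetSum _ fun q _ => integrable_finsetSum _ fun q' _ =>
    integrable_of_continuous ((continuous_gram_apply m σ Z q q').norm.pow 2)

/-- The normalised modes are almost orthonormal in mean square. -/
theorem integral_frobeniusSq_gram_le {m : ℕ} (hm : m ≠ 0) (σ : Fin n → Fin k)
    (hσ : ∀ a, (Finset.univ.filter fun i => σ i = a).card = m) (Z : Finset (Fin d → ℤ)) :
    ∫ X, frobeniusSq (gramError m σ Z X) ∂(positions d n)
      ≤ ((Z.card : ℝ) * k) ^ 2 / m := by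
  unfold frobeniusSq
  have hint : ∀ q q' : Z × Fin k, Integrable (fun X =>
      ‖gramError m σ Z X q q'‖ ^ 2) (positions d n) :=
    fun q q' => integrable_of_continuous ((continuous_gram_apply m σ Z q q').norm.pow 2)
  rw [integral_finsetSum _ fun q _ => integrable_finsetSum _ fun q' _ => hint q q']
  simp_rw [integral_finsetSum _ fun q' _ => hint _ q']
  have hm0 : (0 : ℝ) < m := by positivity
  calc _ ≤ ∑ q : Z × Fin k, ∑ q' : Z × Fin k, (1 : ℝ) / m := by
        refine Finset.sum_le_sum fun q _ => Finset.sum_le_sum fun q' _ => ?_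
        simp only [gram_apply hm σ hσ]
        split_ifs with h
        · have hu : q'.1.1 - q.1.1 ≠ 0 := fun h0 => h.2 (Subtype.ext (sub_eq_zero.1 h0).symm)
          simp only [norm_mul, mul_pow, integral_const_mul]
          rw [integral_norm_sq_sum_mFourier hu, hσ, norm_inv, Complex.norm_natCast]
          apply le_of_eq
          field_simp
        · simp
    _ = _ := by
      simp [Fintype.card_prod]
      ring

theorem integrable_sub_partialFourier {f : UnitAddTorus (Fin d) → ℝ} (hf : IsConnectivity f)
    (Z : Finset (Fin d → ℤ)) :
    Integrable (fun x => ‖(f x : ℂ) - partialFourier f Z x‖ ^ 2) (torusMeasure d) := by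
  refine Integrable.of_bound (C := (1 + Z.card) ^ 2) ?_ (Eventually.of_forall fun x => ?_)
  · have h1 := Complex.measurable_ofReal.comp hf.measurable
    have h2 := (continuous_partialFourier f Z).measurable
    exact ((h1.sub h2).norm.pow_const 2).aestronglyMeasurable
  · rw [Real.norm_eq_abs, abs_of_nonneg (sq_nonneg _)]
    gcongr
    exact (norm_sub_le _ _).trans
      (add_le_add (hf.norm_ofReal_le x) (hf.norm_partialFourier_le Z x))

/-- With `n = k * m` both matrices carry the factor `1 / n`. On the diagonal the mean matrix is
zero, leaving the truncated series at `0`. -/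
theorem norm_sq_mean_sub_apply {m : ℕ} (hnm : n = k * m) (σ : Fin n → Fin k)
    (Z : Finset (Fin d → ℤ)) (X : Fin n → UnitAddTorus (Fin d)) (i j : Fin n) :
    ‖(meanMatrix Fi Fo σ X - modeMatrix m σ Z X * blockMatrix k Fi Fo Z
      * (modeMatrix m σ Z X).conjTranspose) i j‖ ^ 2
      = (if i = j then ‖partialFourier Fi Z 0‖ ^ 2 else
        ‖(((if σ i = σ j then Fi else Fo) (X i - X j) : ℝ) : ℂ)
          - partialFourier (if σ i = σ j then Fi else Fo) Z (X i - X j)‖ ^ 2) / (n : ℝ) ^ 2 := by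
  rw [Matrix.sub_apply, modeMatrix_mul_blockMatrix_mul]
  have hn : (k : ℂ) * m = n := by rw [hnm]; push_cast; rfl
  rw [hn]
  unfold meanMatrix edgeProb connect
  split_ifs with h1 h2
  · subst h1
    simp [div_pow]
  · exact absurd (congrArg σ h1) h2
  all_goals rw [← sub_div, norm_div, div_pow, Complex.norm_natCast]

theorem integrable_mean_sub_apply {m : ℕ} (hnm : n = k * m) (hFi : IsConnectivity Fi)
    (hFo : IsConnectivity Fo) (σ : Fin n → Fin k) (Z : Finset (Fin d → ℤ)) (i j : Fin n) :
    Integrable (fun X => ‖(meanMatrix Fi Fo σ X - modeMatrix m σ Z X * blockMatrix k Fi Fo Z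
      * (modeMatrix m σ Z X).conjTranspose) i j‖ ^ 2) (positions d n) := by
  simp only [norm_sq_mean_sub_apply hnm]
  refine Integrable.div_const ?_ _
  by_cases h1 : i = j
  · simp only [if_pos h1]
    exact integrable_const _
  · simp only [if_neg h1]
    have hf : IsConnectivity (if σ i = σ j then Fi else Fo) := by split_ifs <;> assumption
    exact (measurePreserving_apply_sub_apply h1).integrable_comp_of_integrable
      (integrable_sub_partialFourier hf Z)

/-- The mean matrix is close to the truncated Fourier series in mean square. -/
theorem integral_frobeniusSq_mean_sub_le {m : ℕ} (hnm : n = k * m) (hn : n ≠ 0)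
    (hFi : IsConnectivity Fi)
    (hFo : IsConnectivity Fo) (σ : Fin n → Fin k) (Z : Finset (Fin d → ℤ)) {δ : ℝ} (hδ : 0 ≤ δ)
    (hi : ∫ x, ‖(Fi x : ℂ) - partialFourier Fi Z x‖ ^ 2 ∂(torusMeasure d) ≤ δ)
    (ho : ∫ x, ‖(Fo x : ℂ) - partialFourier Fo Z x‖ ^ 2 ∂(torusMeasure d) ≤ δ) :
    ∫ X, frobeniusSq (meanMatrix Fi Fo σ X - modeMatrix m σ Z X * blockMatrix k Fi Fo Z
      * (modeMatrix m σ Z X).conjTranspose) ∂(positions d n) ≤ (Z.card : ℝ) ^ 2 / n + δ := by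
  unfold frobeniusSq
  have hint := integrable_mean_sub_apply hnm hFi hFo σ Z
  rw [integral_finsetSum _ fun i _ => integrable_finsetSum _ fun j _ => hint i j]
  simp_rw [integral_finsetSum _ fun j _ => hint _ j]
  have hn0 : (0 : ℝ) < n := by positivity
  calc _ ≤ ∑ i : Fin n, ∑ j : Fin n, ((if i = j then (Z.card : ℝ) ^ 2 else 0) + δ) / (n : ℝ) ^ 2 := by
        refine Finset.sum_le_sum fun i _ => Finset.sum_le_sum fun j _ => ?_
        simp only [norm_sq_mean_sub_apply hnm, integral_div]
        gcongr
        -- The `n` diagonal entries together cost at most `|Z| ^ 2 / n`; each other entry has the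
        -- `L²` error of the truncation as its mean.
        by_cases h1 : i = j
        · simp only [if_pos h1]
          simp only [integral_const, probReal_univ, one_smul]
          have := hFi.norm_partialFourier_le Z 0
          have h2 : ‖partialFourier Fi Z 0‖ ^ 2 ≤ (Z.card : ℝ) ^ 2 := by gcongr
          linarith
        · simp only [if_neg h1, zero_add]
          have hf : IsConnectivity (if σ i = σ j then Fi else Fo) := by split_ifs <;> assumption
          have hmp := measurePreserving_apply_sub_apply (d := d) h1
          have := integral_map (μ := positions d n) hmp.measurable.aemeasurable
            (f := fun x => ‖(((if σ i = σ j then Fi else Fo) x : ℝ) : ℂ)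
              - partialFourier (if σ i = σ j then Fi else Fo) Z x‖ ^ 2)
            (by rw [hmp.map_eq]; exact (integrable_sub_partialFourier hf Z).aestronglyMeasurable)
          rw [← this, hmp.map_eq]
          split_ifs <;> assumption
    _ = _ := by
      simp only [← Finset.sum_div, Finset.sum_add_distrib]
      simp
      field_simp

open Classical in
theorem measurable_condProb (hFi : IsConnectivity Fi) (hFo : IsConnectivity Fo)
    (σ : Fin n → Fin k) (G : SimpleGraph (Fin n)) :
    Measurable fun X => condProb Fi Fo σ X G := by
  have hF : ∀ i j, Measurable fun X : Fin n → UnitAddTorus (Fin d) =>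
      connect Fi Fo (X i - X j) (σ i) (σ j) := by
    intro i j
    have h : Measurable fun X : Fin n → UnitAddTorus (Fin d) => X i - X j :=
      Continuous.measurable (by fun_prop)
    unfold connect
    split_ifs
    · exact hFi.measurable.comp h
    · exact hFo.measurable.comp h
  unfold condProb
  refine Finset.measurable_prod _ fun q _ => ?_
  split_ifs
  · exact hF _ _
  · exact (hF _ _).const_sub 1

theorem condProb_nonneg (hFi : IsConnectivity Fi) (hFo : IsConnectivity Fo)
    (σ : Fin n → Fin k) (X : Fin n → UnitAddTorus (Fin d)) (G : SimpleGraph (Fin n)) :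
    0 ≤ condProb Fi Fo σ X G :=
  graphWeight_nonneg (edgeProb_mem_Icc hFi hFo σ X) G

open Classical in
theorem sum_lintegral_condProb (hFi : IsConnectivity Fi) (hFo : IsConnectivity Fo)
    (σ : Fin n → Fin k) :
    ∑ G, ∫⁻ X, ENNReal.ofReal (condProb Fi Fo σ X G) ∂(positions d n) = 1 := by
  rw [← lintegral_finsetSum _ fun G _ => (measurable_condProb hFi hFo σ G).ennreal_ofReal]
  have : ∀ X, ∑ G, ENNReal.ofReal (condProb Fi Fo σ X G) = 1 := by
    intro X
    rw [← ENNReal.ofReal_sum_of_nonneg fun G _ => condProb_nonneg hFi hFo σ X G]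
    simp only [condProb_eq_graphWeight, sum_graphWeight, ENNReal.ofReal_one]
  simp [this]

open Classical in
theorem law_apply (σ : Fin n → Fin k) (S : Set (SimpleGraph (Fin n))) :
    law Fi Fo σ S = ∑ G, (∫⁻ X, ENNReal.ofReal (condProb Fi Fo σ X G) ∂(positions d n))
      * Measure.dirac G S := by
  rw [law, Measure.sum_apply_of_countable, tsum_fintype]
  rfl

theorem law_le_one (hFi : IsConnectivity Fi) (hFo : IsConnectivity Fo)
    (σ : Fin n → Fin k) (S : Set (SimpleGraph (Fin n))) : law Fi Fo σ S ≤ 1 := by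
  classical
  rw [law_apply, ← sum_lintegral_condProb hFi hFo σ]
  exact Finset.sum_le_sum fun G _ => mul_le_of_le_one_right' prob_le_one

open Classical in
/-- A lower bound for the probability of a set of graphs, from a bound for the conditional
probability of its complement. -/
theorem one_sub_le_law (hFi : IsConnectivity Fi) (hFo : IsConnectivity Fo)
    (σ : Fin n → Fin k) (S : Set (SimpleGraph (Fin n))) {B : (Fin n → UnitAddTorus (Fin d)) → ℝ}
    (hB : Integrable B (positions d n))
    (hle : ∀ X, ∑ G ∈ Finset.univ.filter (· ∉ S), condProb Fi Fo σ X G ≤ B X) :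
    1 - ENNReal.ofReal (∫ X, B X ∂(positions d n)) ≤ law Fi Fo σ S := by
  rw [tsub_le_iff_right, ← sum_lintegral_condProb hFi hFo σ,
    ← Finset.sum_filter_add_sum_filter_not Finset.univ (· ∈ S)]
  refine add_le_add ?_ ?_
  · rw [law_apply, ← Finset.sum_filter_add_sum_filter_not Finset.univ (· ∈ S)]
    refine le_trans (le_of_eq ?_) le_self_add
    refine Finset.sum_congr rfl fun G hG => ?_
    rw [Measure.dirac_apply_of_mem (Finset.mem_filter.1 hG).2, mul_one]
  · rw [← lintegral_finsetSum _ fun G _ => (measurable_condProb hFi hFo σ G).ennreal_ofReal,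
      ofReal_integral_eq_lintegral_ofReal hB (Eventually.of_forall fun X =>
        (Finset.sum_nonneg fun G _ => condProb_nonneg hFi hFo σ X G).trans (hle X))]
    refine lintegral_mono fun X => ?_
    rw [← ENNReal.ofReal_sum_of_nonneg fun G _ => condProb_nonneg hFi hFo σ X G]
    exact ENNReal.ofReal_le_ofReal (hle X)

/-- The quantitative form of the theorem. -/
theorem one_sub_le_law_isolatedCluster {m : ℕ} (hk : 2 ≤ k) (hm : m ≠ 0) (hnm : n = k * m)
    (hFi : IsConnectivity Fi) (hFo : IsConnectivity Fo) {g η τ : ℝ}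
    (hg : 0 < g) (hgc : g ≤ (density Fi - density Fo) / k)
    (hg1 : ∀ z, g ≤ ‖(fourierCoef Fi z + ((k : ℂ) - 1) * fourierCoef Fo z) / k
        - ((density Fi - density Fo) / k : ℝ)‖)
    (hg2 : ∀ z, z ≠ 0 → g ≤ ‖(fourierCoef Fi z - fourierCoef Fo z) / k
        - ((density Fi - density Fo) / k : ℝ)‖)
    (hη : 0 < η) (hηg : η ≤ g ^ 2 / 16) (hητ : 5 * η < τ) (hτ : τ < g / 4)
    (σ : Fin n → Fin k) (hσ : ∀ a, (Finset.univ.filter fun i => σ i = a).card = m)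
    {Z : Finset (Fin d → ℤ)} (hZ : (0 : Fin d → ℤ) ∈ Z) {δ : ℝ} (hδ : 0 ≤ δ)
    (hi : ∫ x, ‖(Fi x : ℂ) - partialFourier Fi Z x‖ ^ 2 ∂(torusMeasure d) ≤ δ)
    (ho : ∫ x, ‖(Fo x : ℂ) - partialFourier Fo Z x‖ ^ 2 ∂(torusMeasure d) ≤ δ) :
    1 - ENNReal.ofReal (((Z.card : ℝ) * k) ^ 2 / m / η ^ 2
        + ((Z.card : ℝ) ^ 2 / n + δ) / (η / 3) ^ 2 + 2 / (η / 3) ^ 4 / n)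
      ≤ law Fi Fo σ
        {G | IsolatedCluster G (n * (density Fi - density Fo) / k) τ (g / 4) (k - 1)} := by
  classical
  have hk0 : k ≠ 0 := by omega
  have hn : n ≠ 0 := by rw [hnm]; exact mul_ne_zero hk0 hm
  have hn0 : (0 : ℝ) < n := by positivity
  set E1 : (Fin n → UnitAddTorus (Fin d)) → ℝ := fun X =>
    frobeniusSq (gramError m σ Z X) with hE1
  set E2 : (Fin n → UnitAddTorus (Fin d)) → ℝ := fun X =>
    frobeniusSq (meanMatrix Fi Fo σ X - modeMatrix m σ Z X * blockMatrix k Fi Fo Z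
      * (modeMatrix m σ Z X).conjTranspose) with hE2
  set E3 : (Fin n → UnitAddTorus (Fin d)) → SimpleGraph (Fin n) → ℝ := fun X G =>
    ∑ i, ∑ j, (noise (edgeProb Fi Fo σ X) G
      * (noise (edgeProb Fi Fo σ X) G).transpose) i j ^ 2 with hE3
  have hi1 : Integrable E1 (positions d n) := integrable_frobeniusSq_gram m σ Z
  have hi2 : Integrable E2 (positions d n) :=
    integrable_finsetSum _ fun i _ => integrable_finsetSum _ fun j _ =>
      integrable_mean_sub_apply hnm hFi hFo σ Z i j
  set B : (Fin n → UnitAddTorus (Fin d)) → ℝ := fun X =>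
    E1 X / η ^ 2 + E2 X / (η / 3) ^ 2 + 2 / (η / 3) ^ 4 / n with hB
  have hiB : Integrable B (positions d n) :=
    ((hi1.div_const _).add (hi2.div_const _)).add (integrable_const _)
  have hIB : ∫ X, B X ∂(positions d n) ≤ ((Z.card : ℝ) * k) ^ 2 / m / η ^ 2
        + ((Z.card : ℝ) ^ 2 / n + δ) / (η / 3) ^ 2 + 2 / (η / 3) ^ 4 / n := by
    have e1 : ∫ X, B X ∂(positions d n) = ∫ X, (E1 X / η ^ 2 + E2 X / (η / 3) ^ 2) ∂(positions d n)
        + ∫ _, 2 / (η / 3) ^ 4 / (n : ℝ) ∂(positions d n) :=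
      integral_add ((hi1.div_const _).add (hi2.div_const _)) (integrable_const _)
    rw [e1, integral_add (hi1.div_const _) (hi2.div_const _), integral_div, integral_div]
    simp only [integral_const, probReal_univ, one_smul]
    gcongr
    · exact integral_frobeniusSq_gram_le hm σ hσ Z
    · exact integral_frobeniusSq_mean_sub_le hnm hn hFi hFo σ Z hδ hi ho
  refine (tsub_le_tsub_left (ENNReal.ofReal_le_ofReal hIB) 1).trans
    (one_sub_le_law hFi hFo σ _ hiB fun X => ?_)
  have hcp := condProb_nonneg hFi hFo σ X
  have hE10 : 0 ≤ E1 X := frobeniusSq_nonneg _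
  have hE20 : 0 ≤ E2 X := frobeniusSq_nonneg _
  have hE30 : ∀ G, 0 ≤ E3 X G := fun G =>
    Finset.sum_nonneg fun _ _ => Finset.sum_nonneg fun _ _ => sq_nonneg _
  have hR0 : ∀ G, 0 ≤ E1 X / η ^ 2 + E2 X / (η / 3) ^ 2 + E3 X G / (n * (η / 3)) ^ 4 := by
    intro G
    have := hE30 G
    positivity
  calc ∑ G ∈ Finset.univ.filter _, condProb Fi Fo σ X G
      ≤ ∑ G ∈ Finset.univ.filter (· ∉ {G | IsolatedCluster G
          (n * (density Fi - density Fo) / k) τ (g / 4) (k - 1)}), condProb Fi Fo σ X G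
          * (E1 X / η ^ 2 + E2 X / (η / 3) ^ 2 + E3 X G / (n * (η / 3)) ^ 4) := by
        -- Markov's inequality: off the good event at least one normalised error exceeds `1`, hence
        -- so does their sum.
        refine Finset.sum_le_sum fun G hG => le_mul_of_one_le_right (hcp G) ?_
        by_contra! hlt
        refine (Finset.mem_filter.1 hG).2 ?_
        have a1 : 0 ≤ E1 X / η ^ 2 := by positivity
        have a2 : 0 ≤ E2 X / (η / 3) ^ 2 := by positivity
        have a3 : 0 ≤ E3 X G / (n * (η / 3)) ^ 4 := by have := hE30 G; positivity
        have b1 : E1 X / η ^ 2 ≤ 1 := by linarith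
        have b2 : E2 X / (η / 3) ^ 2 ≤ 1 := by linarith
        have b3 : E3 X G / (n * (η / 3)) ^ 4 ≤ 1 := by linarith
        exact isolatedCluster_of_frobenius hk hm hn hFi hFo hg hgc hg1 hg2 hη hηg hητ hτ σ hZ X G
          ((div_le_one (by positivity)).1 b1)
          ((div_le_one (by positivity)).1 b2)
          ((div_le_one (by positivity)).1 b3)
    _ ≤ ∑ G, condProb Fi Fo σ X G
          * (E1 X / η ^ 2 + E2 X / (η / 3) ^ 2 + E3 X G / (n * (η / 3)) ^ 4) :=
        Finset.sum_le_sum_of_subset_of_nonneg (Finset.filter_subset _ _)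
          fun G _ _ => mul_nonneg (hcp G) (hR0 G)
    _ = (∑ G, condProb Fi Fo σ X G) * (E1 X / η ^ 2 + E2 X / (η / 3) ^ 2)
          + (∑ G, condProb Fi Fo σ X G * E3 X G) / (n * (η / 3)) ^ 4 := by
        rw [Finset.sum_mul, Finset.sum_div, ← Finset.sum_add_distrib]
        exact Finset.sum_congr rfl fun G _ => by ring
    _ ≤ 1 * (E1 X / η ^ 2 + E2 X / (η / 3) ^ 2) + 2 * (n : ℝ) ^ 3 / (n * (η / 3)) ^ 4 := by
        have s1 : ∑ G, condProb Fi Fo σ X G = 1 := sum_graphWeight _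
        have s2 : ∑ G, condProb Fi Fo σ X G * E3 X G ≤ 2 * (n : ℝ) ^ 3 :=
          sum_graphWeight_mul_frobenius_le (edgeProb_mem_Icc hFi hFo σ X)
        rw [s1]
        gcongr
    _ = B X := by
        rw [hB]
        field_simp

end Random

end SGBM

/-! ### Choice of constants and passage to the limit. -/

theorem mainTheorem4 (d k : ℕ) (hk : 2 ≤ k)
    (Fi Fo : UnitAddTorus (Fin d) → ℝ)
    (hFi : SGBM.IsConnectivity Fi) (hFo : SGBM.IsConnectivity Fo)
    (hFi0 : SGBM.FourierSeriesAtZero Fi) (hFo0 : SGBM.FourierSeriesAtZero Fo)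
    (hout : 0 < SGBM.density Fo) (hin : SGBM.density Fo < SGBM.density Fi)
    (h1 : ∀ z : Fin d → ℤ,
      SGBM.fourierCoef Fi z + ((k : ℂ) - 1) * SGBM.fourierCoef Fo z
        ≠ ((SGBM.density Fi - SGBM.density Fo : ℝ) : ℂ))
    (h2 : ∀ z : Fin d → ℤ, z ≠ 0 →
      SGBM.fourierCoef Fi z - SGBM.fourierCoef Fo z
        ≠ ((SGBM.density Fi - SGBM.density Fo : ℝ) : ℂ)) :
    ∃ ε : ℝ, 0 < ε ∧ ∀ τ : ℝ, 0 < τ → τ < ε →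
      ∀ σ : (m : ℕ) → Fin (k * m) → Fin k, (∀ m, SGBM.IsBalanced (σ m)) →
        Tendsto
          (fun m : ℕ => SGBM.law Fi Fo (σ m)
            {G | SGBM.IsolatedCluster G
              (((k * m : ℕ) : ℝ) * (SGBM.density Fi - SGBM.density Fo) / k) τ ε (k - 1)})
          atTop (𝓝 1) := by
  obtain ⟨g, hg, hgc, hg1, hg2⟩ := SGBM.exists_spectral_gap hk hFi hFo hin h1 h2
  refine ⟨g / 4, by positivity, fun τ hτ0 hτ σ hσ => ?_⟩
  obtain ⟨η, hη, hηg, hητ⟩ : ∃ η : ℝ, 0 < η ∧ η ≤ g ^ 2 / 16 ∧ 5 * η < τ :=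
    ⟨min (g ^ 2 / 16) (τ / 6), by positivity, min_le_left _ _, by
      have := min_le_right (g ^ 2 / 16) (τ / 6)
      linarith⟩
  have hk0 : 0 < k := by omega
  have hcard : ∀ m a, (Finset.univ.filter fun i => σ m i = a).card = m := fun m a =>
    Nat.eq_of_mul_eq_mul_left hk0 (hσ m a)
  refine tendsto_order.2 ⟨fun x hx => ?_, fun x hx => Eventually.of_forall fun m =>
    (SGBM.law_le_one hFi hFo (σ m) _).trans_lt hx⟩
  obtain ⟨δ, hδ, hxδ⟩ : ∃ δ : ℝ, 0 < δ ∧ x < 1 - ENNReal.ofReal δ := by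
    have hcont : Tendsto (fun δ : ℝ => 1 - ENNReal.ofReal δ) (𝓝[>] 0) (𝓝 1) := by
      have : Tendsto (fun δ : ℝ => 1 - ENNReal.ofReal δ) (𝓝 0) (𝓝 (1 - ENNReal.ofReal 0)) :=
        ENNReal.Tendsto.sub tendsto_const_nhds (ENNReal.continuous_ofReal.tendsto 0)
          (Or.inl ENNReal.one_ne_top)
      simpa using this.mono_left nhdsWithin_le_nhds
    obtain ⟨δ, h, h'⟩ := ((hcont.eventually (lt_mem_nhds hx)).and self_mem_nhdsWithin).exists
    exact ⟨δ, h', h⟩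
  -- With this tolerance the truncation costs `δ / 2` in probability. `Z` is fixed before `m` grows,
  -- so all terms depending on its size vanish in the limit.
  set δ' : ℝ := δ / 2 * (η / 3) ^ 2 with hδ'
  have hδ'0 : 0 < δ' := by positivity
  obtain ⟨Z, ⟨hi, ho⟩, hZ⟩ := (((hFi.eventually_integral_sub_partialFourier_le hδ'0).and
    (hFo.eventually_integral_sub_partialFourier_le hδ'0)).and
      (eventually_ge_atTop ({0} : Finset (Fin d → ℤ)))).exists
  have hZ0 : (0 : Fin d → ℤ) ∈ Z := hZ (Finset.mem_singleton_self 0)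
  have hlim : Tendsto (fun m : ℕ => ((Z.card : ℝ) * k) ^ 2 / m / η ^ 2
      + ((Z.card : ℝ) ^ 2 / ((k * m : ℕ) : ℝ) + δ') / (η / 3) ^ 2
      + 2 / (η / 3) ^ 4 / ((k * m : ℕ) : ℝ)) atTop (𝓝 (0 / η ^ 2 + (0 + δ') / (η / 3) ^ 2 + 0)) := by
    have hkm : Tendsto (fun m : ℕ => k * m) atTop atTop :=
      tendsto_id.const_mul_atTop' hk0
    have t1 := tendsto_const_div_atTop_nhds_zero_nat (((Z.card : ℝ) * k) ^ 2)
    have t2 := (tendsto_const_div_atTop_nhds_zero_nat ((Z.card : ℝ) ^ 2)).comp hkm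
    have t3 := (tendsto_const_div_atTop_nhds_zero_nat (2 / (η / 3) ^ 4)).comp hkm
    exact ((t1.div_const _).add ((t2.add_const δ').div_const _)).add t3
  have hval : 0 / η ^ 2 + (0 + δ') / (η / 3) ^ 2 + 0 < δ := by
    rw [hδ', zero_div, zero_add, zero_add, add_zero, mul_div_cancel_right₀ _ (by positivity)]
    linarith
  filter_upwards [hlim.eventually (gt_mem_nhds hval), eventually_ne_atTop 0] with m hm hm0
  refine hxδ.trans_le ((tsub_le_tsub_left (ENNReal.ofReal_le_ofReal hm.le) 1).trans ?_)
  exact SGBM.one_sub_le_law_isolatedCluster hk hm0 rfl hFi hFo hg hgc hg1 hg2 hη hηg hητ hτ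
    (σ m) (hcard m) hZ0 hδ'0.le hi ho
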